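/- **Proposition 2.1.** Let $S=(S_k)_{k\ge 0}$ be a $\mathbb Z$-valued random sequence (no independence or random walk structure is assumed), and let $$N(n,x)=\mathrm{card}\{k\in\{0,\dots,n\}: S_k=x\}\qquad (n\in\mathbb N,\ x\in\mathbb Z)$$ be its discrete local time. Write $[\cdot]$ for the integer part (floor). Suppose that: * **(RW1)** there is a real sequence $(a_n)$ with $a_n\to\infty$ and $n^{-1}a_n\to 0$ such that the processes $(a_n^{-1}S_{[nt]})_{t\ge 0}$ converge in law, as $n\to\infty$, in the space $\mathcal D([0,\infty))$ of real càdlàg functions with the Skorokhod ($J_1$) topology, to a process $(Y_t)_{t\ge 0}$ admitting a local time $(L(t,x))_{t\ge 0,\,x\in\mathbb R}$. That is, $L\ge 0$ is finite, for every $t\ge 0$ the map $(x,\omega)\mapsto L(t,x)(\omega)$ is measurable and, almost surely, $\mathrm{Leb}\{s\in[0,t]:Y_s\in B\}=\int_B L(t,x)\,dx$ for every Borel set $B\subseteq\mathbb R$; * **(RW2)** there is some $p\in[1,\infty)$ such that, for all $t>0$ and all $M>0$, $$\lim_{\delta\downarrow 0}\ \limsup_{n\to\infty}\int_{[-M,M]}\mathbb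 E\,\bigl|L_n(t,x)-L_n(t,[x]_\delta)\bigr|^p\,dx=0,$$ where $L_n(t,x)=n^{-1}a_n\,N([nt],[a_nx])$ is the rescaled discrete local time and $[x]_\delta=\delta[\delta^{-1}x]$. Then, for every $m\ge 1$, all $\theta_1,\dots,\theta_m\in\mathbb R$ and all $0<t_1<\dots<t_m$, the function $\sum_{i=1}^m\theta_iL(t_i,\cdot)$ almost surely belongs to $L^p(\mathbb R)$, and, for the same $p$ as in (RW2), $$\sum_{i=1}^m\theta_iL_n(t_i,\cdot)\ \Longrightarrow\ \sum_{i=1}^m\theta_iL(t_i,\cdot)\qquad (n\to\infty)$$ in law in the Banach space $L^p(\mathbb R)$. -/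

import Mathlib

open MeasureTheory ProbabilityTheory Filter Topology Set
open scoped NNReal ENNReal

noncomputable section

/-- `x : [0,∞) → ℝ` is càdlàg: right-continuous with a left limit at every time
(at time `0` the left-limit condition is void). -/
def IsCadlag (x : ℝ≥0 → ℝ) : Prop :=
  ∀ t : ℝ≥0, ContinuousWithinAt x (Ici t) t ∧ ∃ l : ℝ, Tendsto x (𝓝[<] t) (𝓝 l)

/-- The space `D([0,∞))` of real càdlàg functions on `[0,∞)`. -/
def SkorokhodSpace : Type := {x : ℝ≥0 → ℝ // IsCadlag x}

namespace SkorokhodSpace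

instance : CoeFun SkorokhodSpace (fun _ => ℝ≥0 → ℝ) := ⟨Subtype.val⟩

/-- The functions `y` that are `ε`-close to `x` on `[0,T]` after a time change `τ`, an increasing
bijection of `[0,∞)` that moves every time by less than `ε`. -/
def basicNhd (x : SkorokhodSpace) (T : ℝ≥0) (ε : ℝ) : Set SkorokhodSpace :=
  {y | ∃ τ : ℝ≥0 ≃o ℝ≥0, (∀ t, dist (τ t) t < ε) ∧ ∀ t ≤ T, dist (y (τ t)) (x t) < ε}

theorem basicNhd_mono (x : SkorokhodSpace) {T T' : ℝ≥0} {ε ε' : ℝ} (hT : T' ≤ T) (hε : ε ≤ ε') :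
    basicNhd x T ε ⊆ basicNhd x T' ε' := by
  rintro y ⟨τ, h1, h2⟩
  exact ⟨τ, fun t => (h1 t).trans_le hε, fun t ht => (h2 t (ht.trans hT)).trans_le hε⟩

/-- The Skorokhod (`J₁`) topology on `D([0,∞))`. A sequence `xₙ` converges to `x` if and only if
there are time changes `τₙ` with `sup_t |τₙ t - t| → 0` and
`sup_{t ≤ T} |xₙ (τₙ t) - x t| → 0` for every `T`. -/
instance : TopologicalSpace SkorokhodSpace where
  IsOpen U := ∀ x ∈ U, ∃ T : ℝ≥0, ∃ ε : ℝ, 0 < ε ∧ basicNhd x T ε ⊆ U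
  isOpen_univ := fun _ _ => ⟨0, 1, one_pos, subset_univ _⟩
  isOpen_inter := by
    intro U V hU hV x hx
    obtain ⟨T, ε, hε, h⟩ := hU x hx.1
    obtain ⟨T', ε', hε', h'⟩ := hV x hx.2
    exact ⟨max T T', min ε ε', lt_min hε hε', subset_inter
      ((basicNhd_mono x (le_max_left _ _) (min_le_left _ _)).trans h)
      ((basicNhd_mono x (le_max_right _ _) (min_le_right _ _)).trans h')⟩
  isOpen_sUnion := by
    intro 𝒰 h𝒰 x hx
    obtain ⟨U, hU, hxU⟩ := hx
    obtain ⟨T, ε, hε, h⟩ := h𝒰 U hU x hxU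
    exact ⟨T, ε, hε, h.trans (subset_sUnion_of_mem hU)⟩

instance : MeasurableSpace SkorokhodSpace := borel _

instance : BorelSpace SkorokhodSpace := ⟨rfl⟩

end SkorokhodSpace

/-- The Borel `σ`-algebra of the Banach space `L^p(ℝ)`. -/
instance instMeasurableSpaceLpReal (p : ℝ≥0∞) [Fact (1 ≤ p)] :
    MeasurableSpace (Lp ℝ p (volume : Measure ℝ)) := borel _

instance instBorelSpaceLpReal (p : ℝ≥0∞) [Fact (1 ≤ p)] :
    BorelSpace (Lp ℝ p (volume : Measure ℝ)) := ⟨rfl⟩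

theorem isCadlag_floor_mul (c : ℝ≥0) (s : ℕ → ℝ) : IsCadlag (fun t => s ⌊c * t⌋₊) := by
  intro t
  constructor
  · have h : ∀ᶠ u in 𝓝[≥] t, ⌊c * u⌋₊ = ⌊c * t⌋₊ := by
      have h1 : ∀ᶠ u in 𝓝 t, c * u < ⌊c * t⌋₊ + 1 :=
        (continuous_const.mul continuous_id).continuousAt.eventually_lt continuousAt_const
          (Nat.lt_floor_add_one _)
      filter_upwards [mem_nhdsWithin_of_mem_nhds h1, self_mem_nhdsWithin] with u hu hu'
      refine (Nat.floor_eq_iff (by positivity)).2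
        ⟨(Nat.floor_le (by positivity)).trans (mul_le_mul_right (mem_Ici.1 hu') c), hu⟩
    exact tendsto_const_nhds.congr' (h.mono fun u hu => by simp only [hu])
  · have h : ∀ᶠ u in 𝓝[<] t, ⌊c * u⌋₊ = ⌈c * t⌉₊ - 1 := by
      rcases eq_or_ne c 0 with rfl | hc
      · simp
      rcases eq_or_ne t 0 with rfl | ht
      · simp
      have hpos : 0 < c * t := by positivity
      have hceil : 0 < ⌈c * t⌉₊ := Nat.ceil_pos.2 hpos
      have hlt : ((⌈c * t⌉₊ - 1 : ℕ) : ℝ≥0) < c * t := Nat.lt_ceil.1 (by omega)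
      have h1 : ∀ᶠ u in 𝓝 t, ((⌈c * t⌉₊ - 1 : ℕ) : ℝ≥0) < c * u :=
        continuousAt_const.eventually_lt (continuous_const.mul continuous_id).continuousAt hlt
      filter_upwards [mem_nhdsWithin_of_mem_nhds h1, self_mem_nhdsWithin] with u hu hu'
      refine (Nat.floor_eq_iff (by positivity)).2 ⟨hu.le, ?_⟩
      have h2 : c * u < c * t := mul_lt_mul_of_pos_left (mem_Iio.1 hu') (by positivity)
      have h3 : ((⌈c * t⌉₊ - 1 : ℕ) : ℝ≥0) + 1 = (⌈c * t⌉₊ : ℝ≥0) := by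
        exact_mod_cast Nat.sub_add_cancel hceil
      rw [h3]
      exact h2.trans_le (Nat.le_ceil _)
    exact ⟨s (⌈c * t⌉₊ - 1), tendsto_const_nhds.congr' (h.mono fun u hu => by simp only [hu])⟩

/-- The rescaled path `t ↦ a⁻¹ s_[nt]`, an element of `D([0,∞))`. -/
def rescaledPath (a : ℝ) (n : ℕ) (s : ℕ → ℤ) : SkorokhodSpace :=
  ⟨fun t => a⁻¹ * (s ⌊(n : ℝ≥0) * t⌋₊ : ℝ), isCadlag_floor_mul n fun k => a⁻¹ * (s k : ℝ)⟩

/-- The discrete local time `N(n,x) = card {k ∈ {0,…,n} : s_k = x}`. -/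
def discreteLocalTime (s : ℕ → ℤ) (n : ℕ) (x : ℤ) : ℕ :=
  ((Finset.range (n + 1)).filter fun k => s k = x).card

/-- The rescaled discrete local time `n⁻¹ a N([nt],[a x])`. -/
def rescaledLocalTime (a : ℝ) (n : ℕ) (s : ℕ → ℤ) (t : ℝ≥0) (x : ℝ) : ℝ :=
  (n : ℝ)⁻¹ * a * (discreteLocalTime s ⌊(n : ℝ≥0) * t⌋₊ ⌊a * x⌋ : ℝ)

/-- The discretization `[x]_δ = δ [δ⁻¹ x]`. -/
def gridFloor (δ x : ℝ) : ℝ := δ * (⌊δ⁻¹ * x⌋ : ℝ)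

/-- `L` is a local time of the process `Y`: for every `t`, almost surely, `L(t,·)` is a density,
with respect to Lebesgue measure, of the occupation measure
`B ↦ Leb {s ∈ [0,t] : Y_s ∈ B}` of `Y` up to time `t`. -/
structure IsLocalTime {Ω : Type*} [MeasurableSpace Ω] (P : Measure Ω) (Y : Ω → SkorokhodSpace)
    (L : ℝ≥0 → ℝ → Ω → ℝ) : Prop where
  measurable : ∀ t, Measurable fun z : ℝ × Ω => L t z.1 z.2
  nonneg : ∀ t x ω, 0 ≤ L t x ω
  occupation : ∀ t : ℝ≥0, ∀ᵐ ω ∂P, ∀ B : Set ℝ, MeasurableSet B →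
    volume {s : ℝ | 0 ≤ s ∧ s ≤ (t : ℝ) ∧ Y ω s.toNNReal ∈ B} = ∫⁻ x in B, ENNReal.ofReal (L t x ω)

end

/-! ### Càdlàg functions -/

/-! A local time is not a continuous functional of the path, but its integrals against continuous
kernels are: by the occupation formula, the integral of ψ against L(t,·) is ∫_0^t ψ(Y_s) ds, which
is continuous on the Skorokhod space (`SkorokhodSpace.continuous_occupationIntegral`). Local times
are therefore replaced by their weighted averages over the cells of a grid of mesh 1/(J+1),
restricted to a window [-M, M). The result, `stepMap`, is a continuous map from paths to L^p, so
convergence in law of the paths passes through it.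

On the discrete side, the cell averages of the discrete local time agree with `stepMap` of the
rescaled path up to a deterministic error, uniform over all paths
(`eventually_eLpNorm_cellAverage_sub_le`). The L^p distance from a function to its cell averages is
at most 3 times its distance to its values at the grid points (`eLpNorm_sub_cellAverage_le`), and
(RW2) makes the latter small in mean for large n.

On the limit side no regularity of L is assumed; it is inherited from the discrete side. Step maps
of the rescaled path at two fine meshes are both close to the discrete local time, hence to each
other. The truncated norm of their difference is a bounded continuous functional of the path, so the
same closeness holds for Y (`lintegral_stepMap_sub_stepMap_le`). Lebesgue differentiation and
Fatou's lemma send one mesh to 0 and bound the distance from L to its cell averages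
(`eventually_lintegral_sub_cellAverage_le`). This gives both membership in L^p and the approximation
of the limit by `stepMap` of Y.

The window costs little: a path that stays bounded up to the last time has a local time of bounded
support, and `SkorokhodSpace.containment` is a continuous [0,1]-valued functional detecting such
paths, whose expectation also passes to the limit. The two approximations are combined by
`tendstoInDistribution_of_forall_approx`. -/

theorem IsCadlag.measurable {x : ℝ≥0 → ℝ} (hx : IsCadlag x) : Measurable x := by
  have hu : ∀ t : ℝ≥0, Tendsto (fun k : ℕ => ((⌊((k + 1 : ℕ) : ℝ≥0) * t⌋₊ : ℝ≥0) + 1) /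
      ((k + 1 : ℕ) : ℝ≥0)) atTop (𝓝[≥] t) := by
    intro t
    have h1 : ∀ k : ℕ, t ≤ ((⌊((k + 1 : ℕ) : ℝ≥0) * t⌋₊ : ℝ≥0) + 1) / ((k + 1 : ℕ) : ℝ≥0) := by
      intro k
      rw [le_div_iff₀ (by positivity), mul_comm]
      exact (Nat.lt_floor_add_one _).le
    have h2 : ∀ k : ℕ, ((⌊((k + 1 : ℕ) : ℝ≥0) * t⌋₊ : ℝ≥0) + 1) / ((k + 1 : ℕ) : ℝ≥0) ≤
        t + 1 / ((k : ℝ≥0) + 1) := by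
      intro k
      rw [add_div, Nat.cast_add_one]
      gcongr
      rw [div_le_iff₀ (by positivity), mul_comm]
      exact Nat.floor_le (by positivity)
    refine tendsto_nhdsWithin_iff.2 ⟨?_, Eventually.of_forall h1⟩
    refine tendsto_of_tendsto_of_tendsto_of_le_of_le tendsto_const_nhds ?_ h1 h2
    simpa using (tendsto_const_nhds (x := t)).add
      (tendsto_one_div_add_atTop_nhds_zero_nat (𝕜 := ℝ≥0))
  refine measurable_of_tendsto_metrizable (f := fun (k : ℕ) t =>
    x (((⌊((k + 1 : ℕ) : ℝ≥0) * t⌋₊ : ℝ≥0) + 1) / ((k + 1 : ℕ) : ℝ≥0))) (fun k => ?_)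
    (tendsto_pi_nhds.2 fun t => (hx t).1.tendsto.comp (hu t))
  exact (measurable_from_nat (f := fun j : ℕ => x (((j : ℝ≥0) + 1) / ((k + 1 : ℕ) : ℝ≥0)))).comp
    (Nat.measurable_floor.comp (measurable_const_mul _))

/-- At a discontinuity the left limit differs from the value, so some rational q separates them. For
a fixed q and a fixed order of the two, such points are isolated on the left, and a set of
left-isolated points is countable. -/
theorem IsCadlag.countable_not_continuousAt {x : ℝ≥0 → ℝ} (hx : IsCadlag x) :
    {t | ¬ ContinuousAt x t}.Countable := by
  choose hr l hl using hx
  have hA : ∀ q : ℚ, {t | l t < q ∧ (q : ℝ) < x t}.Countable := by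
    intro q
    refine (countable_setOfPred_isolated_left_within
      (s := {t | l t < q ∧ (q : ℝ) < x t})).mono fun t ht => ?_
    refine ⟨ht, ?_⟩
    rw [← empty_mem_iff_bot]
    have h : ∀ᶠ u in 𝓝[<] t, x u < q := (hl t).eventually (gt_mem_nhds ht.1)
    have h' := nhdsWithin_mono t (inter_subset_right (s := {t | l t < q ∧ (q : ℝ) < x t})) h
    filter_upwards [h', self_mem_nhdsWithin] with u hu hu'
    exact absurd hu'.1.2 (not_lt.2 (le_of_lt hu))
  have hB : ∀ q : ℚ, {t | x t < q ∧ (q : ℝ) < l t}.Countable := by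
    intro q
    refine (countable_setOfPred_isolated_left_within
      (s := {t | x t < q ∧ (q : ℝ) < l t})).mono fun t ht => ?_
    refine ⟨ht, ?_⟩
    rw [← empty_mem_iff_bot]
    have h : ∀ᶠ u in 𝓝[<] t, q < x u := (hl t).eventually (lt_mem_nhds ht.2)
    have h' := nhdsWithin_mono t (inter_subset_right (s := {t | x t < q ∧ (q : ℝ) < l t})) h
    filter_upwards [h', self_mem_nhdsWithin] with u hu hu'
    exact absurd hu'.1.1 (not_lt.2 (le_of_lt hu))
  refine ((countable_iUnion hA).union (countable_iUnion hB)).mono fun t ht => ?_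
  have hne : l t ≠ x t := by
    rintro heq
    refine ht (continuousAt_iff_continuous_left'_right'.2
      ⟨?_, (hr t).mono Ioi_subset_Ici_self⟩)
    have := hl t
    rwa [heq] at this
  rcases lt_or_gt_of_ne hne with h | h
  · obtain ⟨q, h1, h2⟩ := exists_rat_btwn h
    exact Or.inl (mem_iUnion.2 ⟨q, h1, h2⟩)
  · obtain ⟨q, h1, h2⟩ := exists_rat_btwn h
    exact Or.inr (mem_iUnion.2 ⟨q, h1, h2⟩)

theorem IsCadlag.exists_abs_le {x : ℝ≥0 → ℝ} (hx : IsCadlag x) (T : ℝ≥0) :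
    ∃ C, ∀ t ≤ T, |x t| ≤ C := by
  have hc : IsCompact (Icc 0 T) := isCompact_Icc
  suffices h : ∃ C, ∀ t ∈ Icc 0 T, |x t| ≤ C by
    obtain ⟨C, hC⟩ := h
    exact ⟨C, fun t ht => hC t ⟨zero_le, ht⟩⟩
  refine hc.induction_on (p := fun s => ∃ C, ∀ t ∈ s, |x t| ≤ C) ⟨0, by simp⟩ ?_ ?_ ?_
  · rintro s t hst ⟨C, hC⟩
    exact ⟨C, fun u hu => hC u (hst hu)⟩
  · rintro s t ⟨C, hC⟩ ⟨C', hC'⟩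
    exact ⟨max C C', fun u hu => hu.elim (fun h => (hC u h).trans (le_max_left _ _))
      fun h => (hC' u h).trans (le_max_right _ _)⟩
  · intro t _
    obtain ⟨h1, l, hl⟩ := hx t
    have e1 : ∀ᶠ u in 𝓝[≥] t, |x u| < |x t| + 1 :=
      (h1.tendsto.abs).eventually (gt_mem_nhds (lt_add_one _))
    have e2 : ∀ᶠ u in 𝓝[<] t, |x u| < |l| + 1 := hl.abs.eventually (gt_mem_nhds (lt_add_one _))
    refine ⟨{u | |x u| ≤ max (|x t| + 1) (|l| + 1)}, mem_nhdsWithin_of_mem_nhds ?_, _,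
      fun u hu => hu⟩
    rw [← nhdsLT_sup_nhdsGE t]
    exact ⟨e2.mono fun u hu => hu.le.trans (le_max_right _ _),
      e1.mono fun u hu => hu.le.trans (le_max_left _ _)⟩

/-! ### Continuous functionals on the Skorokhod space -/

namespace SkorokhodSpace

theorem measurable_coe (x : SkorokhodSpace) : Measurable (x : ℝ≥0 → ℝ) := x.2.measurable

theorem measurable_path (x : SkorokhodSpace) : Measurable fun s : ℝ => x s.toNNReal :=
  x.measurable_coe.comp measurable_real_toNNReal

/-- Openness is defined by containing a basic set around each point, so this criterion needs no
proof that basic sets are themselves neighbourhoods. -/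
theorem continuous_of_basicNhd {E : Type*} [PseudoMetricSpace E] {f : SkorokhodSpace → E}
    (h : ∀ x, ∀ ε > 0, ∃ T : ℝ≥0, ∃ δ : ℝ, 0 < δ ∧ ∀ y ∈ basicNhd x T δ, dist (f y) (f x) < ε) :
    Continuous f := by
  refine ⟨fun U hU x hx => ?_⟩
  obtain ⟨ε, hε, hεU⟩ := Metric.isOpen_iff.1 hU (f x) hx
  obtain ⟨T, δ, hδ, hy⟩ := h x ε hε
  exact ⟨T, δ, hδ, fun y hyx => hεU (hy y hyx)⟩

/-- The value of `y n` at `s` is within 1/(n+1) of the value of `x` at the time-changed point `(τ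
n).symm s`, and these points tend to `s`. -/
theorem tendsto_apply_of_mem_basicNhd {x : SkorokhodSpace} {y : ℕ → SkorokhodSpace}
    (hy : ∀ n : ℕ, y n ∈ basicNhd x n (1 / ((n : ℝ) + 1))) {s : ℝ≥0} (hs : ContinuousAt x s) :
    Tendsto (fun n => y n s) atTop (𝓝 (x s)) := by
  choose τ hτ hyx using hy
  have h0 : Tendsto (fun n : ℕ => 1 / ((n : ℝ) + 1)) atTop (𝓝 0) :=
    tendsto_one_div_add_atTop_nhds_zero_nat
  have h1 : Tendsto (fun n => (τ n).symm s) atTop (𝓝 s) := by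
    refine tendsto_iff_dist_tendsto_zero.2 (squeeze_zero (fun _ => dist_nonneg) (fun n => ?_) h0)
    have := hτ n ((τ n).symm s)
    rw [OrderIso.apply_symm_apply, dist_comm] at this
    exact this.le
  have h2 : ∀ᶠ n in atTop, dist (y n s) (x ((τ n).symm s)) ≤ 1 / ((n : ℝ) + 1) := by
    have hb : ∀ᶠ n in atTop, (τ n).symm s ≤ s + 1 := h1.eventually (Iic_mem_nhds (lt_add_one s))
    have hn : ∀ᶠ n : ℕ in atTop, s + 1 ≤ (n : ℝ≥0) :=
      tendsto_natCast_atTop_atTop.eventually_ge_atTop _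
    filter_upwards [hb, hn] with n h1 h2
    have := hyx n ((τ n).symm s) (h1.trans h2)
    rw [OrderIso.apply_symm_apply] at this
    exact this.le
  have h3 : Tendsto (fun n => dist (y n s) (x ((τ n).symm s))) atTop (𝓝 0) :=
    tendsto_of_tendsto_of_tendsto_of_le_of_le' tendsto_const_nhds h0
      (Eventually.of_forall fun _ => dist_nonneg) h2
  exact (tendsto_iff_of_dist h3).2 (hs.tendsto.comp h1)

theorem ae_continuousAt (x : SkorokhodSpace) : ∀ᵐ s : ℝ, 0 ≤ s → ContinuousAt x s.toNNReal := by
  have h : ((↑) '' {t : ℝ≥0 | ¬ ContinuousAt x t} : Set ℝ).Countable :=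
    x.2.countable_not_continuousAt.image _
  filter_upwards [h.ae_notMem volume] with s hs hs0
  by_contra hc
  exact hs ⟨s.toNNReal, hc, Real.coe_toNNReal s hs0⟩

/-- The integral `∫_0^t ψ (x s) ds` of `ψ` against the occupation measure of `x`. -/
noncomputable def occupationIntegral (ψ : ℝ → ℝ) (t : ℝ≥0) (x : SkorokhodSpace) : ℝ :=
  ∫ s in Icc (0 : ℝ) t, ψ (x s.toNNReal)

/-- If continuity failed at `x`, the choices T = n and δ = 1/(n+1) would give a sequence converging
to `x` pointwise off a countable set of times, and dominated convergence would contradict the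
failure. -/
theorem continuous_occupationIntegral {ψ : ℝ → ℝ} (hψ : Continuous ψ) {C : ℝ}
    (hC : ∀ u, |ψ u| ≤ C) (t : ℝ≥0) : Continuous (occupationIntegral ψ t) := by
  refine continuous_of_basicNhd fun x ε hε => ?_
  by_contra! hcon
  have hpos : ∀ n : ℕ, 0 < 1 / ((n : ℝ) + 1) := fun n => by positivity
  choose y hy hyε using fun n : ℕ => hcon n _ (hpos n)
  have hlim : Tendsto (fun n => occupationIntegral ψ t (y n)) atTop
      (𝓝 (occupationIntegral ψ t x)) := by
    refine tendsto_integral_of_dominated_convergence (fun _ => C)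
      (fun n => (hψ.measurable.comp (y n).measurable_path).aestronglyMeasurable)
      (integrable_const C) (fun n => ae_of_all _ fun s => hC _) ?_
    filter_upwards [ae_restrict_of_ae x.ae_continuousAt, ae_restrict_mem measurableSet_Icc]
      with s hs hs'
    exact (hψ.tendsto _).comp (tendsto_apply_of_mem_basicNhd hy (hs hs'.1))
  obtain ⟨n, hn⟩ := ((tendsto_iff_dist_tendsto_zero.1 hlim).eventually (gt_mem_nhds hε)).exists
  exact absurd hn (not_lt.2 (hyε n))

/-! ### Continuous detection of paths confined to a bounded window -/

/-- A continuous cutoff, equal to `1` on `[-M, M]` and to `0` outside `(-M-1, M+1)`. -/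
noncomputable def cutoff (M u : ℝ) : ℝ := max 0 (min 1 (M + 1 - |u|))

theorem cutoff_nonneg (M u : ℝ) : 0 ≤ cutoff M u := le_max_left _ _

theorem cutoff_le_one (M u : ℝ) : cutoff M u ≤ 1 := max_le zero_le_one (min_le_left _ _)

theorem cutoff_eq_one {M u : ℝ} (h : |u| ≤ M) : cutoff M u = 1 := by
  rw [cutoff, min_eq_left (by linarith), max_eq_right zero_le_one]

theorem cutoff_eq_zero {M u : ℝ} (h : M + 1 ≤ |u|) : cutoff M u = 0 :=
  max_eq_left ((min_le_right _ _).trans (by linarith))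

theorem cutoff_le_add (M u v : ℝ) : cutoff M u ≤ cutoff M v + |u - v| := by
  have h : |v| ≤ |u| + |u - v| := by
    have := abs_sub_abs_le_abs_sub v u
    rw [abs_sub_comm] at this
    linarith
  have h0 := abs_nonneg (u - v)
  unfold cutoff
  refine max_le (add_nonneg (le_max_left _ _) h0) ?_
  rcases le_total 1 (M + 1 - |v|) with h1 | h1
  · have := min_le_left 1 (M + 1 - |u|)
    rw [min_eq_left h1]
    linarith [le_max_right (0 : ℝ) 1]
  · have := min_le_right 1 (M + 1 - |u|)
    rw [min_eq_right h1]
    linarith [le_max_right (0 : ℝ) (M + 1 - |v|)]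

/-- The infimum of `cutoff M (x r)` over `r ∈ [0, s]`. -/
noncomputable def infCutoff (M : ℝ) (x : SkorokhodSpace) (s : ℝ) : ℝ :=
  ⨅ r : Iic s.toNNReal, cutoff M (x r)

theorem bddBelow_cutoff (M : ℝ) (x : SkorokhodSpace) (s : ℝ) :
    BddBelow (range fun r : Iic s.toNNReal => cutoff M (x r)) :=
  ⟨0, by rintro _ ⟨r, rfl⟩; exact cutoff_nonneg _ _⟩

theorem infCutoff_nonneg (M : ℝ) (x : SkorokhodSpace) (s : ℝ) : 0 ≤ infCutoff M x s :=
  Real.iInf_nonneg fun _ => cutoff_nonneg _ _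

theorem infCutoff_le {M : ℝ} {x : SkorokhodSpace} {s : ℝ} {r : ℝ≥0} (hr : r ≤ s.toNNReal) :
    infCutoff M x s ≤ cutoff M (x r) :=
  ciInf_le (bddBelow_cutoff M x s) (⟨r, hr⟩ : Iic s.toNNReal)

theorem infCutoff_le_one (M : ℝ) (x : SkorokhodSpace) (s : ℝ) : infCutoff M x s ≤ 1 :=
  (infCutoff_le zero_le).trans (cutoff_le_one _ _)

theorem infCutoff_antitone (M : ℝ) (x : SkorokhodSpace) : Antitone (infCutoff M x) := by
  intro s s' hs
  exact le_ciInf fun r => infCutoff_le (r.2.trans (Real.toNNReal_le_toNNReal hs))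

/-- The average over `s ∈ [t, t+1]` of `infCutoff M x s`. -/
noncomputable def containment (M : ℝ) (t : ℝ≥0) (x : SkorokhodSpace) : ℝ :=
  ∫ s in (t : ℝ)..t + 1, infCutoff M x s

theorem intervalIntegrable_infCutoff (M : ℝ) (x : SkorokhodSpace) (a b : ℝ) :
    IntervalIntegrable (infCutoff M x) volume a b :=
  (infCutoff_antitone M x).intervalIntegrable

theorem containment_nonneg (M : ℝ) (t : ℝ≥0) (x : SkorokhodSpace) : 0 ≤ containment M t x :=
  intervalIntegral.integral_nonneg (by linarith) fun _ _ => infCutoff_nonneg _ _ _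

theorem integral_infCutoff_le (M : ℝ) (x : SkorokhodSpace) {a b : ℝ} (hab : a ≤ b) :
    ∫ s in a..b, infCutoff M x s ≤ b - a := by
  have := intervalIntegral.integral_mono_on hab (intervalIntegrable_infCutoff M x a b)
    (intervalIntegrable_const (c := (1 : ℝ))) fun s _ => infCutoff_le_one M x s
  simpa using this

theorem containment_le_one (M : ℝ) (t : ℝ≥0) (x : SkorokhodSpace) : containment M t x ≤ 1 := by
  have := integral_infCutoff_le M x (a := t) (b := t + 1) (by linarith)
  unfold containment
  linarith

theorem containment_eq_one {M : ℝ} {t : ℝ≥0} {x : SkorokhodSpace}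
    (h : ∀ r ≤ t + 1, |x r| ≤ M) : containment M t x = 1 := by
  have h1 : ∀ s ∈ uIcc (t : ℝ) (t + 1), infCutoff M x s = 1 := by
    intro s hs
    rw [uIcc_of_le (by linarith)] at hs
    have : ∀ r : Iic s.toNNReal, cutoff M (x r) = 1 := fun r => cutoff_eq_one
      (h r (r.2.trans (Real.toNNReal_le_iff_le_coe.2 (by push_cast; exact hs.2))))
    simp only [infCutoff, this, ciInf_const]
  rw [containment, intervalIntegral.integral_congr h1]
  simp

theorem abs_lt_of_containment_ne_zero {M : ℝ} {t : ℝ≥0} {x : SkorokhodSpace}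
    (h : containment M t x ≠ 0) {r : ℝ≥0} (hr : r ≤ t) : |x r| < M + 1 := by
  by_contra! hx
  refine h ?_
  have h1 : ∀ s ∈ uIcc (t : ℝ) (t + 1), infCutoff M x s = 0 := by
    intro s hs
    rw [uIcc_of_le (by linarith)] at hs
    refine le_antisymm ?_ (infCutoff_nonneg _ _ _)
    rw [← cutoff_eq_zero hx]
    refine infCutoff_le (hr.trans ?_)
    rw [← Real.toNNReal_coe (r := t)]
    exact Real.toNNReal_le_toNNReal hs.1
  rw [containment, intervalIntegral.integral_congr h1]
  simp

/-- A time r ≤ s - ε is moved by the time change to a time at most s, where `y` is within ε of `x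
r`; the cutoff is 1-Lipschitz. -/
theorem infCutoff_le_of_mem_basicNhd {M : ℝ} {x y : SkorokhodSpace} {T : ℝ≥0} {ε : ℝ}
    (hy : y ∈ basicNhd x T ε) {s : ℝ} (hs : s ≤ T) :
    infCutoff M y s ≤ infCutoff M x (s - ε) + ε := by
  obtain ⟨τ, hτ, hyx⟩ := hy
  rw [← sub_le_iff_le_add]
  refine le_ciInf fun r => ?_
  rw [sub_le_iff_le_add]
  have hε : 0 < ε := dist_nonneg.trans_lt (hτ 0)
  have hr : (r : ℝ≥0) ≤ (s - ε).toNNReal := r.2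
  have hrs : (r : ℝ≥0) ≤ s.toNNReal := hr.trans (Real.toNNReal_le_toNNReal (by linarith))
  have hτr : τ r ≤ s.toNNReal := by
    rcases le_or_gt s ε with h | h
    -- Here `(s - ε).toNNReal` is 0, so only r = 0 remains, and an order isomorphism of [0,∞) fixes
    -- 0.
    · have h0 : (r : ℝ≥0) = 0 := by
        refine le_antisymm (hr.trans ?_) zero_le
        rw [Real.toNNReal_of_nonpos (by linarith)]
      rw [h0, show (0 : ℝ≥0) = ⊥ from rfl, OrderIso.map_bot]
      exact bot_le
    · have h1 := hτ r
      rw [NNReal.dist_eq] at h1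
      have h2 := (abs_lt.1 h1).2
      have h3 : ((r : ℝ≥0) : ℝ) ≤ s - ε := by
        have := NNReal.coe_le_coe.2 hr
        rwa [Real.coe_toNNReal _ (by linarith)] at this
      exact Real.le_toNNReal_iff_coe_le (by linarith) |>.2 (by linarith)
  have hrT : (r : ℝ≥0) ≤ T := hrs.trans (Real.toNNReal_le_iff_le_coe.2 hs)
  calc infCutoff M y s ≤ cutoff M (y (τ r)) := infCutoff_le hτr
    _ ≤ cutoff M (x r) + |y (τ r) - x r| := cutoff_le_add _ _ _
    _ ≤ cutoff M (x r) + ε := by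
        gcongr
        exact (hyx r hrT).le

theorem le_infCutoff_of_mem_basicNhd {M : ℝ} {x y : SkorokhodSpace} {T : ℝ≥0} {ε : ℝ}
    (hy : y ∈ basicNhd x T ε) {s : ℝ} (hs0 : 0 ≤ s) (hs : s + ε ≤ T) :
    infCutoff M x (s + ε) - ε ≤ infCutoff M y s := by
  obtain ⟨τ, hτ, hyx⟩ := hy
  refine le_ciInf fun r => ?_
  rw [sub_le_iff_le_add]
  have hε : 0 < ε := dist_nonneg.trans_lt (hτ 0)
  have hr : ((r : ℝ≥0) : ℝ) ≤ s := (Real.le_toNNReal_iff_coe_le hs0).1 r.2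
  have h1 := hτ (τ.symm r)
  rw [NNReal.dist_eq, OrderIso.apply_symm_apply] at h1
  have h2 := (abs_lt.1 h1).1
  have h3 : ((τ.symm r : ℝ≥0) : ℝ) ≤ s + ε := by linarith
  have h4 := hyx (τ.symm r) (NNReal.coe_le_coe.1 (h3.trans hs))
  rw [OrderIso.apply_symm_apply] at h4
  calc infCutoff M x (s + ε) ≤ cutoff M (x (τ.symm r)) :=
        infCutoff_le ((Real.le_toNNReal_iff_coe_le (by linarith)).2 h3)
    _ ≤ cutoff M (y r) + |x (τ.symm r) - y r| := cutoff_le_add _ _ _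
    _ ≤ cutoff M (y r) + ε := by
        gcongr
        rw [abs_sub_comm]
        exact h4.le

/-- An infimum up to a fixed time is not `J₁`-continuous, since a jump can be moved across that
time; averaging the time over a unit interval cures this. Closeness η changes the values by at most
η and shifts the time by at most η, and the shift changes the integral by at most η because the
integrand lies in [0,1]. -/
theorem continuous_containment (M : ℝ) (t : ℝ≥0) : Continuous (containment M t) := by
  refine continuous_of_basicNhd fun x ε hε => ?_
  set η : ℝ := min 1 (ε / 3) with hη
  have hη0 : 0 < η := lt_min one_pos (by linarith)
  have hη1 : η ≤ 1 := min_le_left _ _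
  have hη2 : η ≤ ε / 3 := min_le_right _ _
  -- The horizon t + 2 contains s + η for every s ≤ t + 1, since η ≤ 1.
  refine ⟨t + 2, η, hη0, fun y hy => ?_⟩
  have hI := fun z : SkorokhodSpace => intervalIntegrable_infCutoff M z
  have ht : (t : ℝ) ≤ t + 1 := by linarith
  have hT : ((t + 2 : ℝ≥0) : ℝ) = t + 2 := by push_cast; ring
  have hI' : ∀ c, IntervalIntegrable (fun s => infCutoff M x (s + c)) volume t (t + 1) := fun c =>
    Antitone.intervalIntegrable fun s s' h => infCutoff_antitone M x (by linarith)
  have ub : containment M t y ≤ containment M t x + 2 * η := by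
    have h1 : containment M t y ≤ ∫ s in (t : ℝ)..t + 1, (infCutoff M x (s + -η) + η) := by
      refine intervalIntegral.integral_mono_on ht (hI y _ _)
        ((hI' (-η)).add intervalIntegrable_const) fun s hs => ?_
      exact infCutoff_le_of_mem_basicNhd hy (by rw [hT]; linarith [hs.2])
    rw [intervalIntegral.integral_add (hI' (-η)) intervalIntegrable_const,
      intervalIntegral.integral_const,
      intervalIntegral.integral_comp_add_right (fun s => infCutoff M x s)] at h1
    have h2 := intervalIntegral.integral_add_adjacent_intervals (hI x (t + -η) t)
      (hI x t (t + 1 + -η))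
    have h3 := intervalIntegral.integral_add_adjacent_intervals (hI x t (t + 1 + -η))
      (hI x (t + 1 + -η) (t + 1))
    have h4 := integral_infCutoff_le M x (a := t + -η) (b := t) (by linarith)
    have h5 : 0 ≤ ∫ s in (t : ℝ) + 1 + -η..t + 1, infCutoff M x s :=
      intervalIntegral.integral_nonneg (by linarith) fun _ _ => infCutoff_nonneg _ _ _
    simp only [add_sub_cancel_left, smul_eq_mul, one_mul] at h1
    unfold containment at h1 ⊢
    linarith
  have lb : containment M t x ≤ containment M t y + 2 * η := by
    have h1 : ∫ s in (t : ℝ)..t + 1, (infCutoff M x (s + η) - η) ≤ containment M t y := by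
      refine intervalIntegral.integral_mono_on ht
        ((hI' η).sub intervalIntegrable_const) (hI y _ _) fun s hs => ?_
      exact le_infCutoff_of_mem_basicNhd hy (t.2.trans hs.1) (by rw [hT]; linarith [hs.2])
    rw [intervalIntegral.integral_sub (hI' η) intervalIntegrable_const,
      intervalIntegral.integral_const,
      intervalIntegral.integral_comp_add_right (fun s => infCutoff M x s)] at h1
    have h2 := intervalIntegral.integral_add_adjacent_intervals (hI x t (t + η))
      (hI x (t + η) (t + 1))
    have h3 := intervalIntegral.integral_add_adjacent_intervals (hI x (t + η) (t + 1))
      (hI x (t + 1) (t + 1 + η))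
    have h4 := integral_infCutoff_le M x (a := t) (b := t + η) (by linarith)
    have h5 : 0 ≤ ∫ s in (t : ℝ) + 1..t + 1 + η, infCutoff M x s :=
      intervalIntegral.integral_nonneg (by linarith) fun _ _ => infCutoff_nonneg _ _ _
    simp only [add_sub_cancel_left, smul_eq_mul, one_mul] at h1
    unfold containment at h1 ⊢
    linarith
  rw [Real.dist_eq, abs_lt]
  constructor <;> linarith

end SkorokhodSpace

/-! ### Averaging over the cells of a grid -/

/-- A continuous probability density supported in `[0, 1]`. -/
noncomputable def bump (u : ℝ) : ℝ := max 0 (6 * u * (1 - u))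

theorem continuous_bump : Continuous bump := by unfold bump; fun_prop

theorem bump_nonneg (u : ℝ) : 0 ≤ bump u := le_max_left _ _

theorem bump_le_two (u : ℝ) : bump u ≤ 2 :=
  max_le zero_le_two (by nlinarith [sq_nonneg (u - 1 / 2)])

theorem bump_eq_zero {u : ℝ} (hu : u ∉ Ioo (0 : ℝ) 1) : bump u = 0 := by
  refine max_eq_left ?_
  rw [mem_Ioo, not_and_or, not_lt, not_lt] at hu
  rcases hu with h | h <;> nlinarith

theorem integral_bump : ∫ u, bump u = 1 := by
  have h1 : ∫ u, bump u = ∫ u in Ioc (0 : ℝ) 1, bump u := by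
    refine (setIntegral_eq_integral_of_forall_compl_eq_zero fun u hu => bump_eq_zero ?_).symm
    exact fun h => hu (Ioo_subset_Ioc_self h)
  rw [h1, ← intervalIntegral.integral_of_le zero_le_one]
  have h2 : EqOn bump (fun u => 6 * u - 6 * u ^ 2) (uIcc 0 1) := by
    intro u hu
    rw [uIcc_of_le zero_le_one] at hu
    have : 0 ≤ 6 * u * (1 - u) := by nlinarith [hu.1, hu.2]
    simp only [bump, max_eq_right this]
    ring
  rw [intervalIntegral.integral_congr h2, intervalIntegral.integral_sub
    (Continuous.intervalIntegrable (by fun_prop) _ _)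
    (Continuous.intervalIntegrable (by fun_prop) _ _)]
  rw [intervalIntegral.integral_const_mul, intervalIntegral.integral_const_mul, integral_pow,
    integral_id]
  norm_num

/-- The cell `[jδ, (j+1)δ)` of the grid of mesh `δ`. -/
def cell (δ : ℝ) (j : ℤ) : Set ℝ := {x | ⌊δ⁻¹ * x⌋ = j}

theorem mem_cell {δ : ℝ} {j : ℤ} {x : ℝ} : x ∈ cell δ j ↔ ⌊δ⁻¹ * x⌋ = j := Iff.rfl

theorem measurableSet_cell (δ : ℝ) (j : ℤ) : MeasurableSet (cell δ j) :=
  (Int.measurable_floor.comp (measurable_const_mul δ⁻¹)) (measurableSet_singleton j)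

theorem volume_floor_mul_eq {c : ℝ} (hc : c ≠ 0) (j : ℤ) :
    volume {x : ℝ | ⌊c * x⌋ = j} = ENNReal.ofReal |c⁻¹| := by
  have : {x : ℝ | ⌊c * x⌋ = j} = (c * ·) ⁻¹' Ico (j : ℝ) (j + 1) := by
    ext x
    exact Int.floor_eq_iff
  rw [this, Real.volume_preimage_mul_left hc]
  simp

theorem volume_cell {δ : ℝ} (hδ : 0 < δ) (j : ℤ) : volume (cell δ j) = ENNReal.ofReal δ := by
  rw [cell, volume_floor_mul_eq (inv_ne_zero hδ.ne'), inv_inv, abs_of_pos hδ]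

theorem cell_subset_closedBall {δ : ℝ} (hδ : 0 < δ) {j : ℤ} {x : ℝ} (hx : x ∈ cell δ j) :
    cell δ j ⊆ Metric.closedBall x δ := by
  intro y hy
  have h1 := Int.floor_eq_iff.1 (mem_cell.1 hx)
  have h2 := Int.floor_eq_iff.1 (mem_cell.1 hy)
  rw [Metric.mem_closedBall, Real.dist_eq]
  have h3 : |δ⁻¹ * y - δ⁻¹ * x| ≤ 1 := abs_le.2 ⟨by linarith, by linarith⟩
  rw [← mul_sub, abs_mul, abs_of_pos (inv_pos.2 hδ), inv_mul_le_iff₀ hδ, mul_one] at h3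
  exact h3

/-- A continuous probability density supported in the cell `[jδ, (j+1)δ)`. -/
noncomputable def cellKernel (δ : ℝ) (j : ℤ) (x : ℝ) : ℝ := δ⁻¹ * bump (δ⁻¹ * x - j)

theorem continuous_cellKernel (δ : ℝ) (j : ℤ) : Continuous (cellKernel δ j) :=
  continuous_const.mul (continuous_bump.comp (by fun_prop))

theorem abs_cellKernel_le {δ : ℝ} (hδ : 0 < δ) (j : ℤ) (x : ℝ) :
    |cellKernel δ j x| ≤ 2 * δ⁻¹ := by
  have h0 := inv_pos.2 hδ
  rw [cellKernel, abs_of_nonneg (mul_nonneg h0.le (bump_nonneg _)), mul_comm]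
  exact mul_le_mul_of_nonneg_right (bump_le_two _) h0.le

theorem cellKernel_eq_zero {δ : ℝ} {j : ℤ} {x : ℝ} (hx : x ∉ cell δ j) :
    cellKernel δ j x = 0 := by
  rw [cellKernel, bump_eq_zero, mul_zero]
  rintro ⟨h1, h2⟩
  exact hx (Int.floor_eq_iff.2 ⟨by linarith, by linarith⟩)

theorem integral_cellKernel {δ : ℝ} (hδ : 0 < δ) (j : ℤ) : ∫ x, cellKernel δ j x = 1 := by
  simp only [cellKernel]
  rw [integral_const_mul, Measure.integral_comp_mul_left (fun u => bump (u - j)),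
    integral_sub_right_eq_self bump, integral_bump, inv_inv, abs_of_pos hδ, smul_eq_mul, mul_one,
    inv_mul_cancel₀ hδ.ne']

theorem hasCompactSupport_cellKernel {δ : ℝ} (hδ : 0 < δ) (j : ℤ) :
    HasCompactSupport (cellKernel δ j) := by
  refine HasCompactSupport.intro (isCompact_closedBall (δ * j) δ) fun x hx => ?_
  refine cellKernel_eq_zero fun h => hx (cell_subset_closedBall hδ ?_ h)
  rw [mem_cell, inv_mul_cancel_left₀ hδ.ne', Int.floor_intCast]

theorem uniformContinuous_cellKernel {δ : ℝ} (hδ : 0 < δ) (j : ℤ) :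
    UniformContinuous (cellKernel δ j) :=
  (hasCompactSupport_cellKernel hδ j).uniformContinuous_of_continuous (continuous_cellKernel δ j)

theorem integrable_cellKernel {δ : ℝ} (hδ : 0 < δ) (j : ℤ) : Integrable (cellKernel δ j) :=
  (continuous_cellKernel δ j).integrable_of_hasCompactSupport (hasCompactSupport_cellKernel hδ j)

theorem MeasureTheory.Integrable.cellKernel_mul {δ : ℝ} (hδ : 0 < δ) (j : ℤ) {f : ℝ → ℝ}
    (hf : Integrable f) : Integrable fun y => cellKernel δ j y * f y :=
  hf.bdd_mul (c := 2 * δ⁻¹) (continuous_cellKernel δ j).aestronglyMeasurable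
    (ae_of_all _ fun x => abs_cellKernel_le hδ j x)

/-- The kernel has integral 1, so c can be moved under the integral; it vanishes off the cell and is
at most 2/δ there. -/
theorem abs_integral_cellKernel_mul_sub_le {δ : ℝ} (hδ : 0 < δ) (j : ℤ) {f : ℝ → ℝ}
    (hf : Integrable f) (c : ℝ) :
    |(∫ y, cellKernel δ j y * f y) - c| ≤ 2 * δ⁻¹ * ∫ y in cell δ j, |f y - c| := by
  have h1 : (∫ y, cellKernel δ j y * f y) - c = ∫ y, cellKernel δ j y * (f y - c) := by
    simp only [mul_sub]
    rw [integral_sub (hf.cellKernel_mul hδ j) ((integrable_cellKernel hδ j).mul_const c),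
      integral_mul_const, integral_cellKernel hδ, one_mul]
  have h2 : ∫ y, cellKernel δ j y * (f y - c) = ∫ y in cell δ j, cellKernel δ j y * (f y - c) :=
    (setIntegral_eq_integral_of_forall_compl_eq_zero fun y hy => by
      rw [cellKernel_eq_zero hy, zero_mul]).symm
  rw [h1, h2, ← integral_const_mul, ← Real.norm_eq_abs]
  have hfin : IsFiniteMeasure (volume.restrict (cell δ j)) :=
    ⟨by rw [Measure.restrict_apply_univ, volume_cell hδ]; exact ENNReal.ofReal_lt_top⟩
  refine norm_integral_le_of_norm_le
    (((hf.restrict (s := cell δ j)).sub (integrable_const c)).abs.const_mul _)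
    (ae_of_all _ fun y => ?_)
  rw [norm_mul]
  exact mul_le_mul_of_nonneg_right (abs_cellKernel_le hδ j y) (abs_nonneg _)

/-- The function that is constant on each cell, with value a weighted average of `f` there. -/
noncomputable def cellAverage (δ : ℝ) (f : ℝ → ℝ) (x : ℝ) : ℝ :=
  ∫ y, cellKernel δ ⌊δ⁻¹ * x⌋ y * f y

theorem measurable_cellAverage (δ : ℝ) (f : ℝ → ℝ) : Measurable (cellAverage δ f) :=
  (measurable_of_countable fun j : ℤ => ∫ y, cellKernel δ j y * f y).comp
    (Int.measurable_floor.comp (measurable_const_mul δ⁻¹))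

theorem cellAverage_sum {ι : Type*} (s : Finset ι) {δ : ℝ} (hδ : 0 < δ) (θ : ι → ℝ)
    {f : ι → ℝ → ℝ} (hf : ∀ i ∈ s, Integrable (f i)) (x : ℝ) :
    cellAverage δ (fun y => ∑ i ∈ s, θ i * f i y) x = ∑ i ∈ s, θ i * cellAverage δ (f i) x := by
  simp only [cellAverage, Finset.mul_sum]
  rw [integral_finsetSum]
  · refine Finset.sum_congr rfl fun i _ => ?_
    rw [← integral_const_mul]
    refine integral_congr_ae (ae_of_all _ fun y => ?_)
    simp only
    ring
  · intro i hi
    exact ((hf i hi).const_mul (θ i)).cellKernel_mul hδ _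

theorem measurable_gridFloor (δ : ℝ) : Measurable (gridFloor δ) :=
  (measurable_of_countable fun j : ℤ => δ * (j : ℝ)).comp
    (Int.measurable_floor.comp (measurable_const_mul δ⁻¹))

/-- On one cell both the average and the grid value c are constants, and they differ by at most 2/δ
times the L^1 norm of f - c. Hölder's inequality passes to the L^p norm, and the powers of δ cancel:
δ^(-1) · δ^(1-1/p) · δ^(1/p) = 1. The constant is thus independent of the mesh. -/
theorem eLpNorm_cellAverage_sub_cell_le {δ : ℝ} (hδ : 0 < δ) (j : ℤ) {f : ℝ → ℝ}
    (hf : Integrable f) {p : ℝ≥0∞} (hp1 : 1 ≤ p) (hp : p ≠ ∞) :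
    eLpNorm (fun x => cellAverage δ f x - f (gridFloor δ x)) p (volume.restrict (cell δ j)) ≤
      2 * eLpNorm (fun x => f x - f (gridFloor δ x)) p (volume.restrict (cell δ j)) := by
  set μ := volume.restrict (cell δ j) with hμ
  have hμu : μ univ = ENNReal.ofReal δ := by rw [hμ, Measure.restrict_apply_univ, volume_cell hδ]
  have hp0 : 0 < p.toReal := ENNReal.toReal_pos (one_pos.trans_le hp1).ne' hp
  have hδ0 : ENNReal.ofReal δ ≠ 0 := by simpa using hδ
  have hmem : ∀ᵐ x ∂μ, x ∈ cell δ j := ae_restrict_mem (measurableSet_cell δ j)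
  set c := f (δ * j) with hc
  have hgrid : ∀ᵐ x ∂μ, f (gridFloor δ x) = c := by
    filter_upwards [hmem] with x hx
    rw [gridFloor, mem_cell.1 hx]
  have hfin : IsFiniteMeasure μ := ⟨by rw [hμu]; exact ENNReal.ofReal_lt_top⟩
  have hint : Integrable (fun y => f y - c) μ := hf.restrict.sub (integrable_const c)
  have h1 : eLpNorm (fun x => cellAverage δ f x - f (gridFloor δ x)) p μ ≤
      eLpNorm (fun _ : ℝ => 2 * δ⁻¹ * ∫ y in cell δ j, |f y - c|) p μ := by
    refine eLpNorm_mono_ae ?_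
    filter_upwards [hmem, hgrid] with x hx hx'
    rw [hx', cellAverage, mem_cell.1 hx]
    exact (abs_integral_cellKernel_mul_sub_le hδ j hf c).trans (le_abs_self _)
  have h2 : eLpNorm (fun x => f x - f (gridFloor δ x)) p μ = eLpNorm (fun x => f x - c) p μ := by
    refine eLpNorm_congr_ae ?_
    filter_upwards [hgrid] with x hx
    rw [hx]
  have h3 : eLpNorm (fun x => f x - c) 1 μ ≤ eLpNorm (fun x => f x - c) p μ *
      ENNReal.ofReal δ ^ (1 - 1 / p.toReal) := by
    have := eLpNorm_le_eLpNorm_mul_rpow_measure_univ hp1 hint.aestronglyMeasurable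
    rwa [hμu, ENNReal.toReal_one, div_one] at this
  have h4 : ‖2 * δ⁻¹ * ∫ y in cell δ j, |f y - c|‖ₑ =
      2 * (ENNReal.ofReal δ)⁻¹ * eLpNorm (fun x => f x - c) 1 μ := by
    rw [eLpNorm_one_eq_lintegral_enorm, enorm_mul, enorm_mul]
    congr 1
    · rw [enorm_inv hδ.ne', Real.enorm_of_nonneg hδ.le, Real.enorm_of_nonneg zero_le_two]
      simp
    · rw [Real.enorm_of_nonneg (integral_nonneg fun _ => abs_nonneg _),
        ofReal_integral_eq_lintegral_ofReal hint.abs (ae_of_all _ fun _ => abs_nonneg _)]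
      refine lintegral_congr fun y => ?_
      rw [← Real.enorm_eq_ofReal_abs]
  rw [eLpNorm_const' _ (one_pos.trans_le hp1).ne' hp, h4, hμu] at h1
  rw [h2]
  refine h1.trans ?_
  calc 2 * (ENNReal.ofReal δ)⁻¹ * eLpNorm (fun x => f x - c) 1 μ *
        ENNReal.ofReal δ ^ (1 / p.toReal)
      ≤ 2 * (ENNReal.ofReal δ)⁻¹ * (eLpNorm (fun x => f x - c) p μ *
        ENNReal.ofReal δ ^ (1 - 1 / p.toReal)) * ENNReal.ofReal δ ^ (1 / p.toReal) := by gcongr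
    _ = 2 * eLpNorm (fun x => f x - c) p μ * ((ENNReal.ofReal δ)⁻¹ *
        (ENNReal.ofReal δ ^ (1 - 1 / p.toReal) * ENNReal.ofReal δ ^ (1 / p.toReal))) := by ring
    _ = 2 * eLpNorm (fun x => f x - c) p μ := by
        rw [← ENNReal.rpow_add _ _ hδ0 ENNReal.ofReal_ne_top, sub_add_cancel, ENNReal.rpow_one,
          ENNReal.inv_mul_cancel hδ0 ENNReal.ofReal_ne_top, mul_one]

/-- The p-th powers of the norms add up over disjoint pieces. -/
theorem eLpNorm_biUnion_le {α ι E F : Type*} [MeasurableSpace α] {μ : Measure α}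
    [NormedAddCommGroup E] [NormedAddCommGroup F] {p : ℝ≥0∞} (hp0 : p ≠ 0) (hp : p ≠ ∞)
    {f : α → E} {g : α → F} {K : ℝ≥0∞} {T : Finset ι} {s : ι → Set α}
    (hd : Set.PairwiseDisjoint (T : Set ι) s) (hs : ∀ i ∈ T, MeasurableSet (s i))
    (h : ∀ i ∈ T, eLpNorm f p (μ.restrict (s i)) ≤ K * eLpNorm g p (μ.restrict (s i))) :
    eLpNorm f p (μ.restrict (⋃ i ∈ T, s i)) ≤ K * eLpNorm g p (μ.restrict (⋃ i ∈ T, s i)) := by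
  have hp' : 0 < p.toReal := ENNReal.toReal_pos hp0 hp
  rw [← ENNReal.rpow_le_rpow_iff hp', ENNReal.mul_rpow_of_nonneg _ _ hp'.le]
  simp only [eLpNorm_eq_lintegral_rpow_enorm_toReal hp0 hp, one_div, ENNReal.rpow_inv_rpow hp'.ne']
    at h ⊢
  rw [lintegral_biUnion_finset hd hs, lintegral_biUnion_finset hd hs, Finset.mul_sum]
  refine Finset.sum_le_sum fun i hi => ?_
  have := ENNReal.rpow_le_rpow (h i hi) hp'.le
  rwa [ENNReal.mul_rpow_of_nonneg _ _ hp'.le, ENNReal.rpow_inv_rpow hp'.ne',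
    ENNReal.rpow_inv_rpow hp'.ne'] at this

/-- The mesh `1 / (J + 1)`. -/
noncomputable def mesh (J : ℕ) : ℝ := ((J : ℝ) + 1)⁻¹

theorem mesh_pos (J : ℕ) : 0 < mesh J := by unfold mesh; positivity

theorem tendsto_mesh : Tendsto mesh atTop (𝓝[>] 0) := by
  refine tendsto_nhdsWithin_iff.2 ⟨?_, Eventually.of_forall mesh_pos⟩
  unfold mesh
  simpa using tendsto_one_div_add_atTop_nhds_zero_nat (𝕜 := ℝ)

/-- The indices of the cells of mesh `1 / (J + 1)` that make up `[-M, M)`. -/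
noncomputable def cellIndices (M J : ℕ) : Finset ℤ :=
  Finset.Ico (-((M : ℤ) * (J + 1))) (M * (J + 1))

theorem floor_mem_cellIndices {M J : ℕ} {x : ℝ} :
    ⌊(mesh J)⁻¹ * x⌋ ∈ cellIndices M J ↔ x ∈ Ico (-(M : ℝ)) M := by
  have hJ : (0 : ℝ) < (J : ℝ) + 1 := by positivity
  rw [cellIndices, Finset.mem_Ico, Int.le_floor, Int.floor_lt, mesh, inv_inv, mem_Ico]
  push_cast
  rw [← neg_mul, mul_comm (-(M : ℝ)), mul_comm (M : ℝ), mul_le_mul_iff_right₀ hJ,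
    mul_lt_mul_iff_right₀ hJ]

theorem biUnion_cell (M J : ℕ) :
    ⋃ j ∈ cellIndices M J, cell (mesh J) j = Ico (-(M : ℝ)) M := by
  ext x
  simp only [mem_iUnion, mem_cell, exists_prop, exists_eq_right', floor_mem_cellIndices]

theorem pairwiseDisjoint_cell (s : Set ℤ) (δ : ℝ) : s.PairwiseDisjoint (cell δ) := by
  intro i _ j _ hij
  refine Set.disjoint_left.2 fun x hi hj => hij ?_
  rw [← mem_cell.1 hi, mem_cell.1 hj]

/-- This brings in the quantity controlled by (RW2). Passing through the grid value costs 1 + 2 = 3;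
the window is an exact union of cells, so the bound on each cell can be summed. -/
theorem eLpNorm_sub_cellAverage_le (M J : ℕ) {f : ℝ → ℝ}
    (hf : Integrable f) (hfm : Measurable f) {p : ℝ≥0∞} (hp1 : 1 ≤ p) (hp : p ≠ ∞) :
    eLpNorm (fun x => f x - cellAverage (mesh J) f x) p
        (volume.restrict (Ico (-(M : ℝ)) M)) ≤
      3 * eLpNorm (fun x => f x - f (gridFloor (mesh J) x)) p
        (volume.restrict (Ico (-(M : ℝ)) M)) := by
  set μ := volume.restrict (Ico (-(M : ℝ)) M)
  have h1 : eLpNorm (fun x => cellAverage (mesh J) f x - f (gridFloor (mesh J) x)) p μ ≤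
      2 * eLpNorm (fun x => f x - f (gridFloor (mesh J) x)) p μ := by
    simp only [μ, ← biUnion_cell M J]
    exact eLpNorm_biUnion_le (one_pos.trans_le hp1).ne' hp (pairwiseDisjoint_cell _ _)
      (fun j _ => measurableSet_cell _ _)
      fun j _ => eLpNorm_cellAverage_sub_cell_le (mesh_pos J) j hf hp1 hp
  have hg : Measurable fun x => f (gridFloor (mesh J) x) := hfm.comp (measurable_gridFloor _)
  have hA := measurable_cellAverage (mesh J) f
  have h2 : (fun x => f x - cellAverage (mesh J) f x) =
      (fun x => f x - f (gridFloor (mesh J) x)) -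
        fun x => cellAverage (mesh J) f x - f (gridFloor (mesh J) x) := by
    ext x
    simp
  rw [h2]
  calc _ ≤ eLpNorm (fun x => f x - f (gridFloor (mesh J) x)) p μ +
        eLpNorm (fun x => cellAverage (mesh J) f x - f (gridFloor (mesh J) x)) p μ :=
        eLpNorm_sub_le (hfm.sub hg).aestronglyMeasurable (hA.sub hg).aestronglyMeasurable hp1
    _ ≤ _ := add_le_add le_rfl h1
    _ = _ := by ring

/-- Lebesgue differentiation: the cell of x lies in the ball of radius δ about x. The factor 4 is
the kernel bound 2/δ times the length 2δ of the ball. -/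
theorem ae_tendsto_cellAverage {f : ℝ → ℝ} (hf : Integrable f) :
    ∀ᵐ x, Tendsto (fun J => cellAverage (mesh J) f x) atTop (𝓝 (f x)) := by
  filter_upwards [IsUnifLocDoublingMeasure.ae_tendsto_average_norm_sub volume
    hf.locallyIntegrable 1] with x hx
  have h := hx (fun _ : ℕ => x) mesh tendsto_mesh (Eventually.of_forall fun J => by
    rw [one_mul]; exact Metric.mem_closedBall_self (mesh_pos J).le)
  rw [tendsto_iff_dist_tendsto_zero]
  refine squeeze_zero (fun _ => dist_nonneg) (fun J => ?_) (by simpa using h.const_mul 4)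
  have hδ := mesh_pos J
  have hint : IntegrableOn (fun y => |f y - f x|) (Metric.closedBall x (mesh J)) := by
    have : IsFiniteMeasure (volume.restrict (Metric.closedBall x (mesh J))) :=
      ⟨by rw [Measure.restrict_apply_univ]; exact measure_closedBall_lt_top⟩
    exact (hf.integrableOn.sub (integrable_const (f x))).abs
  calc dist (cellAverage (mesh J) f x) (f x)
      ≤ 2 * (mesh J)⁻¹ * ∫ y in cell (mesh J) ⌊(mesh J)⁻¹ * x⌋, |f y - f x| :=
        abs_integral_cellKernel_mul_sub_le hδ _ hf (f x)
    _ ≤ 2 * (mesh J)⁻¹ * ∫ y in Metric.closedBall x (mesh J), |f y - f x| := by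
        refine mul_le_mul_of_nonneg_left ?_ (by positivity)
        exact setIntegral_mono_set hint (ae_of_all _ fun _ => abs_nonneg _)
          (cell_subset_closedBall hδ (mem_cell.2 rfl)).eventuallyLE
    _ = 4 * ⨍ y in Metric.closedBall x (mesh J), ‖f y - f x‖ := by
        rw [setAverage_eq, measureReal_def, Real.volume_closedBall,
          ENNReal.toReal_ofReal (by positivity), smul_eq_mul]
        simp only [Real.norm_eq_abs]
        rw [mul_inv]
        ring

/-! ### Convergence in distribution by approximation -/

theorem enorm_integral_comp_sub_le {Ω E : Type*} [MeasurableSpace Ω] {Q : Measure Ω}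
    [IsProbabilityMeasure Q] [NormedAddCommGroup E] [MeasurableSpace E] {f : E → ℝ}
    (hfm : Measurable f) {B : ℝ} (hfb : ∀ u, ‖f u‖ ≤ B) {R : ℝ≥0}
    (hfR : ∀ u v, ‖f u - f v‖ₑ ≤ R * min 1 ‖u - v‖ₑ) {X X' : Ω → E} (hX : AEMeasurable X Q)
    (hX' : AEMeasurable X' Q) {ε : ℝ≥0∞} (hε : ∫⁻ ω, min 1 ‖X ω - X' ω‖ₑ ∂Q ≤ ε) :
    ‖∫ ω, f (X ω) ∂Q - ∫ ω, f (X' ω) ∂Q‖ₑ ≤ R * ε := by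
  have hi : Integrable (fun ω => f (X ω)) Q := Integrable.of_bound
    (hfm.comp_aemeasurable hX).aestronglyMeasurable _ (ae_of_all _ fun ω => hfb _)
  have hi' : Integrable (fun ω => f (X' ω)) Q := Integrable.of_bound
    (hfm.comp_aemeasurable hX').aestronglyMeasurable _ (ae_of_all _ fun ω => hfb _)
  rw [← integral_sub hi hi']
  refine (enorm_integral_le_lintegral_enorm _).trans ?_
  refine (lintegral_mono fun ω => hfR (X ω) (X' ω)).trans ?_
  rw [lintegral_const_mul' _ _ ENNReal.coe_ne_top]
  gcongr

/-- If `X n` and `Z` are, up to arbitrarily small errors in probability, continuous images of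
`Yn n` and `Y`, then convergence in distribution of `Yn n` to `Y` implies that of `X n` to `Z`. -/
theorem tendstoInDistribution_of_forall_approx {Ω Ω' D E : Type*} [MeasurableSpace Ω]
    [MeasurableSpace Ω'] {P : Measure Ω} [IsProbabilityMeasure P] {P' : Measure Ω'}
    [IsProbabilityMeasure P'] [TopologicalSpace D] [MeasurableSpace D] [OpensMeasurableSpace D]
    [NormedAddCommGroup E] [MeasurableSpace E] [BorelSpace E]
    {Yn : ℕ → Ω → D} {Y : Ω' → D} (hY : TendstoInDistribution Yn atTop Y (fun _ => P) P')
    {X : ℕ → Ω → E} {Z : Ω' → E} (hX : ∀ n, AEMeasurable (X n) P) (hZ : AEMeasurable Z P')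
    (h : ∀ ε : ℝ≥0∞, 0 < ε → ∃ W : D → E, Continuous W ∧ Measurable W ∧
      (∀ᶠ n in atTop, ∫⁻ ω, min 1 ‖X n ω - W (Yn n ω)‖ₑ ∂P ≤ ε) ∧
      ∫⁻ ω, min 1 ‖Z ω - W (Y ω)‖ₑ ∂P' ≤ ε) :
    TendstoInDistribution X atTop Z (fun _ => P) P' := by
  refine ⟨hX, hZ, tendsto_iff_forall_lipschitz_integral_tendsto.2 ?_⟩
  rintro f ⟨C, hC⟩ ⟨K, hK⟩
  have hfm : Measurable f := hK.continuous.measurable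
  simp only [ProbabilityMeasure.coe_mk]
  simp_rw [integral_map (hX _) hK.continuous.aestronglyMeasurable]
  rw [integral_map hZ hK.continuous.aestronglyMeasurable]
  have hfb : ∀ u, ‖f u‖ ≤ |f 0| + C := fun u => by
    have h1 := hC u 0
    rw [Real.dist_eq] at h1
    have h2 := abs_sub_abs_le_abs_sub (f u) (f 0)
    rw [Real.norm_eq_abs]
    linarith
  -- R bounds both the oscillation and the Lipschitz constant of f, so that closeness in the
  -- truncated distance min(1, ‖u - v‖) suffices.
  set R : ℝ≥0 := max C.toNNReal K with hR
  have hfR : ∀ u v, ‖f u - f v‖ₑ ≤ R * min 1 ‖u - v‖ₑ := by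
    intro u v
    rw [mul_min, mul_one, ← edist_eq_enorm_sub, ← edist_eq_enorm_sub]
    refine le_min ?_ ((hK u v).trans (by gcongr; exact le_max_right _ _))
    rw [edist_dist]
    exact (ENNReal.ofReal_le_ofReal (hC u v)).trans (ENNReal.coe_le_coe.2 (le_max_left _ _))
  rw [tendsto_iff_edist_tendsto_0, ENNReal.tendsto_nhds_zero]
  intro ε hε
  have hε3 : 0 < ε / 3 := ENNReal.div_pos hε.ne' (by simp)
  obtain ⟨η, hη, hRη⟩ : ∃ η : ℝ≥0∞, 0 < η ∧ R * η ≤ ε / 3 := by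
    refine ⟨ε / 3 / (R + 1), ENNReal.div_pos hε3.ne' (by simp), ?_⟩
    calc (R : ℝ≥0∞) * (ε / 3 / (R + 1)) ≤ (R + 1) * (ε / 3 / (R + 1)) := by
          gcongr; exact le_self_add
      _ ≤ ε / 3 := ENNReal.mul_div_le
  obtain ⟨W, hW, hWm, h1, h2⟩ := h η hη
  have h3 : Tendsto (fun n => ∫ ω, f (W (Yn n ω)) ∂P) atTop (𝓝 (∫ ω, f (W (Y ω)) ∂P')) := by
    have h4 := ProbabilityMeasure.tendsto_iff_forall_integral_tendsto.1 hY.tendsto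
      (BoundedContinuousFunction.ofNormedAddCommGroup (fun x => f (W x))
        (hK.continuous.comp hW) _ fun x => hfb _)
    simp only [ProbabilityMeasure.coe_mk, BoundedContinuousFunction.coe_ofNormedAddCommGroup] at h4
    have hm : Measurable fun x => f (W x) := hfm.comp hWm
    simp_rw [integral_map (hY.forall_aemeasurable _) hm.aestronglyMeasurable] at h4
    rwa [integral_map hY.aemeasurable_limit hm.aestronglyMeasurable] at h4
  rw [tendsto_iff_edist_tendsto_0, ENNReal.tendsto_nhds_zero] at h3
  filter_upwards [h1, h3 _ hε3] with n hn1 hn3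
  have e1 := enorm_integral_comp_sub_le hfm hfb hfR (hX n)
    (hWm.comp_aemeasurable (hY.forall_aemeasurable n)) hn1
  have e2 := enorm_integral_comp_sub_le hfm hfb hfR hZ
    (hWm.comp_aemeasurable hY.aemeasurable_limit) h2
  rw [← edist_eq_enorm_sub] at e1 e2
  rw [edist_comm] at e2
  refine (edist_triangle4 _ _ _ _).trans (((add_le_add (add_le_add e1 hn3) e2)).trans ?_)
  refine (add_le_add (add_le_add hRη le_rfl) hRη).trans (le_of_eq ?_)
  exact ENNReal.add_thirds ε

/-! ### Discrete local times -/

/-- For a > 0 each visit spreads mass 1/n uniformly over the cell of length 1/a starting at the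
rescaled position. -/
theorem rescaledLocalTime_eq_sum (a : ℝ) (n : ℕ) (s : ℕ → ℤ) (t : ℝ≥0) (x : ℝ) :
    rescaledLocalTime a n s t x = ∑ k ∈ Finset.range (⌊(n : ℝ≥0) * t⌋₊ + 1),
      (n : ℝ)⁻¹ * (a * (cell a⁻¹ (s k)).indicator 1 x) := by
  simp only [rescaledLocalTime, discreteLocalTime, Finset.card_filter]
  push_cast
  rw [Finset.mul_sum]
  refine Finset.sum_congr rfl fun k _ => ?_
  by_cases hx : x ∈ cell a⁻¹ (s k)
  · rw [indicator_of_mem hx, Pi.one_apply, mul_assoc]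
    rw [mem_cell, inv_inv] at hx
    rw [if_pos hx.symm]
  · rw [indicator_of_notMem hx, mul_assoc]
    rw [mem_cell, inv_inv] at hx
    rw [if_neg (Ne.symm hx)]

theorem volume_cell_inv_ne_top {a : ℝ} (ha : a ≠ 0) (z : ℤ) : volume (cell a⁻¹ z) ≠ ∞ := by
  rw [cell, inv_inv, volume_floor_mul_eq ha]
  exact ENNReal.ofReal_ne_top

theorem memLp_rescaledLocalTime (a : ℝ) (n : ℕ) (s : ℕ → ℤ) (t : ℝ≥0) (p : ℝ≥0∞) :
    MemLp (rescaledLocalTime a n s t) p := by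
  rw [show rescaledLocalTime a n s t = fun x => _ from
    funext (rescaledLocalTime_eq_sum a n s t)]
  refine memLp_finsetSum _ fun k _ => MemLp.const_mul ?_ _
  rcases eq_or_ne a 0 with rfl | ha
  · simp
  · exact (memLp_indicator_const p (measurableSet_cell _ _) (1 : ℝ)
      (Or.inr (volume_cell_inv_ne_top ha _))).const_mul a

theorem integrable_rescaledLocalTime (a : ℝ) (n : ℕ) (s : ℕ → ℤ) (t : ℝ≥0) :
    Integrable (rescaledLocalTime a n s t) :=
  memLp_one_iff_integrable.1 (memLp_rescaledLocalTime a n s t 1)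

theorem measurable_rescaledLocalTime (a : ℝ) (n : ℕ) (s : ℕ → ℤ) (t : ℝ≥0) :
    Measurable (rescaledLocalTime a n s t) := by
  rw [show rescaledLocalTime a n s t = fun x => _ from
    funext (rescaledLocalTime_eq_sum a n s t)]
  exact Finset.measurable_fun_sum _ fun k _ =>
    ((measurable_one.indicator (measurableSet_cell _ _)).const_mul a).const_mul _

theorem measurable_rescaledLocalTime_prod {Ω : Type*} [MeasurableSpace Ω] {S : ℕ → Ω → ℤ}
    (hS : ∀ k, Measurable (S k)) (a : ℝ) (n : ℕ) (t : ℝ≥0) {g : ℝ → ℝ}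
    (hg : Measurable g) :
    Measurable fun z : ℝ × Ω => rescaledLocalTime a n (fun k => S k z.2) t (g z.1) := by
  simp only [rescaledLocalTime_eq_sum]
  refine Finset.measurable_fun_sum _ fun k _ => Measurable.const_mul (Measurable.const_mul ?_ a) _
  have : (fun z : ℝ × Ω => (cell a⁻¹ (S k z.2)).indicator (1 : ℝ → ℝ) (g z.1)) =
      {z : ℝ × Ω | ⌊a⁻¹⁻¹ * g z.1⌋ = S k z.2}.indicator 1 := by
    ext z
    by_cases hz : g z.1 ∈ cell a⁻¹ (S k z.2)
    · rw [indicator_of_mem hz, indicator_of_mem (by exact hz)]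
      rfl
    · rw [indicator_of_notMem hz, indicator_of_notMem (by exact hz)]
  rw [this]
  exact measurable_one.indicator (measurableSet_eq_fun
    (Int.measurable_floor.comp ((hg.comp measurable_fst).const_mul _)) ((hS k).comp measurable_snd))

theorem rescaledLocalTime_congr {a : ℝ} {n : ℕ} {s s' : ℕ → ℤ} {t : ℝ≥0}
    (h : ∀ k ≤ ⌊(n : ℝ≥0) * t⌋₊, s k = s' k) :
    rescaledLocalTime a n s t = rescaledLocalTime a n s' t := by
  ext x
  simp only [rescaledLocalTime_eq_sum]
  refine Finset.sum_congr rfl fun k hk => ?_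
  rw [h k (Finset.mem_range_succ_iff.1 hk)]

/-- The cell of a visited point has length 1/a ≤ 1, which accounts for the passage from M + 1 to M +
2. -/
theorem rescaledLocalTime_eq_zero {a : ℝ} (ha : 1 ≤ a) {n : ℕ} (hn : n ≠ 0) {s : ℕ → ℤ} {t : ℝ≥0}
    {M : ℝ} (h : ∀ r ≤ t, |rescaledPath a n s r| < M + 1) {x : ℝ}
    (hx : x ∉ Ico (-(M + 2)) (M + 2)) :
    rescaledLocalTime a n s t x = 0 := by
  have ha0 : 0 < a := one_pos.trans_le ha
  have hn0 : (0 : ℝ≥0) < n := by exact_mod_cast Nat.pos_of_ne_zero hn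
  rw [rescaledLocalTime_eq_sum]
  refine Finset.sum_eq_zero fun k hk => ?_
  rw [indicator_of_notMem, mul_zero, mul_zero]
  intro hxk
  refine hx ?_
  rw [mem_cell, inv_inv, Int.floor_eq_iff] at hxk
  have hk' : (k : ℝ≥0) ≤ n * t := (Nat.le_floor_iff (by positivity)).1
    (Finset.mem_range_succ_iff.1 hk)
  have h1 := h ((k : ℝ≥0) / n) (by rw [div_le_iff₀ hn0, mul_comm]; exact hk')
  simp only [rescaledPath] at h1
  rw [mul_div_cancel₀ _ hn0.ne', Nat.floor_natCast, abs_mul, abs_inv, abs_of_pos ha0,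
    inv_mul_lt_iff₀ ha0, abs_lt] at h1
  have h3 : a * x < a * (M + 2) := by nlinarith
  have h4 : a * (-(M + 2)) ≤ a * x := by nlinarith
  exact ⟨le_of_mul_le_mul_left h4 ha0, lt_of_mul_lt_mul_left h3 ha0.le⟩

/-- The map factors through a finite power of ℤ, a countable space on which every function is
measurable; nothing is asked of `G` beyond its dependence on finitely many terms. -/
theorem measurable_of_finitely_many {Ω β : Type*} [MeasurableSpace Ω] [MeasurableSpace β]
    {S : ℕ → Ω → ℤ} (hS : ∀ k, Measurable (S k)) (N : ℕ) {G : (ℕ → ℤ) → β}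
    (hG : ∀ s s' : ℕ → ℤ, (∀ k ≤ N, s k = s' k) → G s = G s') :
    Measurable fun ω => G fun k => S k ω := by
  have h : (fun ω => G fun k => S k ω) =
      (fun v : Fin (N + 1) → ℤ => G fun k => if hk : k < N + 1 then v ⟨k, hk⟩ else 0) ∘
        fun ω (k : Fin (N + 1)) => S k ω := by
    ext ω
    refine hG _ _ fun k hk => ?_
    rw [dif_pos (Nat.lt_succ_of_le hk)]
  rw [h]
  exact (measurable_of_countable _).comp (measurable_pi_lambda _ fun k => hS k)

theorem integral_mul_rescaledLocalTime (a : ℝ) (n : ℕ) (s : ℕ → ℤ) (t : ℝ≥0) {ψ : ℝ → ℝ}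
    (hψ : Continuous ψ) {C : ℝ} (hC : ∀ u, |ψ u| ≤ C) (ha : a ≠ 0) :
    ∫ x, ψ x * rescaledLocalTime a n s t x = ∑ k ∈ Finset.range (⌊(n : ℝ≥0) * t⌋₊ + 1),
      (n : ℝ)⁻¹ * (a * ∫ x in cell a⁻¹ (s k), ψ x) := by
  simp only [rescaledLocalTime_eq_sum, Finset.mul_sum]
  have hI : ∀ k, Integrable ((cell a⁻¹ (s k)).indicator ψ) := fun k => by
    rw [integrable_indicator_iff (measurableSet_cell _ _)]
    exact Measure.integrableOn_of_bounded (volume_cell_inv_ne_top ha _)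
      hψ.aestronglyMeasurable (ae_of_all _ hC)
  have hE : ∀ k x, ψ x * ((n : ℝ)⁻¹ * (a * (cell a⁻¹ (s k)).indicator 1 x)) =
      (n : ℝ)⁻¹ * (a * (cell a⁻¹ (s k)).indicator ψ x) := fun k x => by
    by_cases hx : x ∈ cell a⁻¹ (s k) <;> simp [hx]
    ring
  simp only [hE]
  rw [integral_finsetSum _ fun k _ => ((hI k).const_mul a).const_mul _]
  refine Finset.sum_congr rfl fun k _ => ?_
  rw [integral_const_mul, integral_const_mul, integral_indicator (measurableSet_cell _ _)]

theorem abs_mul_integral_cell_sub_le {a η : ℝ} (ha : 0 < a) {ψ : ℝ → ℝ} (hψ : Continuous ψ)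
    {C : ℝ} (hC : ∀ u, |ψ u| ≤ C) (hη : ∀ u v, |u - v| ≤ a⁻¹ → |ψ u - ψ v| ≤ η) (z : ℤ) :
    |a * (∫ x in cell a⁻¹ z, ψ x) - ψ (a⁻¹ * z)| ≤ η := by
  have hv : volume.real (cell a⁻¹ z) = a⁻¹ := by
    rw [measureReal_def, volume_cell (inv_pos.2 ha), ENNReal.toReal_ofReal (inv_pos.2 ha).le]
  have htop := volume_cell_inv_ne_top ha.ne' z
  have hI : IntegrableOn ψ (cell a⁻¹ z) := Measure.integrableOn_of_bounded htop
    hψ.aestronglyMeasurable (ae_of_all _ hC)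
  have h1 : a * (∫ x in cell a⁻¹ z, ψ x) - ψ (a⁻¹ * z) =
      a * ∫ x in cell a⁻¹ z, (ψ x - ψ (a⁻¹ * z)) := by
    rw [integral_sub hI (integrableOn_const htop), setIntegral_const, hv, smul_eq_mul]
    field_simp
  have h2 : ‖∫ x in cell a⁻¹ z, (ψ x - ψ (a⁻¹ * z))‖ ≤ η * a⁻¹ := by
    have hz : a⁻¹ * (z : ℝ) ∈ cell a⁻¹ z := by
      rw [mem_cell, inv_inv, mul_inv_cancel_left₀ ha.ne', Int.floor_intCast]
    have := norm_setIntegral_le_of_norm_le_const (μ := volume) (C := η)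
      (f := fun x => ψ x - ψ (a⁻¹ * z)) htop.lt_top fun x hx =>
        hη x (a⁻¹ * z) (cell_subset_closedBall (inv_pos.2 ha) hz hx)
    rwa [hv] at this
  rw [h1, abs_mul, abs_of_pos ha]
  calc a * |∫ x in cell a⁻¹ z, (ψ x - ψ (a⁻¹ * z))| ≤ a * (η * a⁻¹) :=
        mul_le_mul_of_nonneg_left h2 ha.le
    _ = η := by field_simp

theorem sum_eq_integral_rescaledPath (a : ℝ) {n : ℕ} (hn : n ≠ 0) (s : ℕ → ℤ) {ψ : ℝ → ℝ}
    (hψ : Continuous ψ) {C : ℝ} (hC : ∀ u, |ψ u| ≤ C) (N : ℕ) :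
    ∑ k ∈ Finset.range N, (n : ℝ)⁻¹ * ψ (a⁻¹ * s k) =
      ∫ u in (0 : ℝ)..N / n, ψ (rescaledPath a n s u.toNNReal) := by
  have hn0 : (0 : ℝ) < n := by exact_mod_cast Nat.pos_of_ne_zero hn
  have hI : ∀ b c : ℝ, IntervalIntegrable (fun u : ℝ => ψ (rescaledPath a n s u.toNNReal))
      volume b c := fun b c => by
    refine (intervalIntegrable_const (c := C)).mono_fun
      (hψ.measurable.comp (rescaledPath a n s).measurable_path).aestronglyMeasurable
      (ae_of_all _ fun u => (hC _).trans (le_abs_self C))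
  have h := intervalIntegral.sum_integral_adjacent_intervals (μ := volume)
    (f := fun u : ℝ => ψ (rescaledPath a n s u.toNNReal)) (a := fun k : ℕ => (k : ℝ) / n)
    (n := N) fun k _ => hI _ _
  simp only [Nat.cast_zero, zero_div] at h
  rw [← h]
  refine Finset.sum_congr rfl fun k _ => ?_
  have hle : (k : ℝ) / n ≤ ((k + 1 : ℕ) : ℝ) / n := by gcongr; simp
  rw [intervalIntegral.integral_of_le hle, integral_Ioc_eq_integral_Ioo,
    setIntegral_congr_fun (g := fun _ => ψ (a⁻¹ * s k)) measurableSet_Ioo, setIntegral_const]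
  · rw [measureReal_def, Real.volume_Ioo, ENNReal.toReal_ofReal (by linarith), smul_eq_mul]
    push_cast
    congr 1
    field_simp
    ring
  · intro u hu
    have hu0 : 0 ≤ u := le_trans (by positivity) hu.1.le
    have h1 := (div_lt_iff₀ hn0).1 hu.1
    have h2 := (lt_div_iff₀ hn0).1 hu.2
    have : ⌊(n : ℝ≥0) * u.toNNReal⌋₊ = k := by
      rw [Nat.floor_eq_iff zero_le]
      constructor
      · rw [← NNReal.coe_le_coe]
        push_cast
        rw [Real.coe_toNNReal u hu0]
        linarith
      · rw [← NNReal.coe_lt_coe]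
        push_cast at h2 ⊢
        rw [Real.coe_toNNReal u hu0]
        linarith
    simp only [rescaledPath, this]

/-- Replacing the mean of ψ over a cell by its value at the visited point costs η/n per visit, over
[nt] + 1 ≤ n(t + 1) visits. The resulting sum is the integral of ψ along the path up to time ([nt] +
1)/n, which exceeds t by at most 1/n. -/
theorem abs_integral_mul_rescaledLocalTime_sub_le {a η : ℝ} (ha : 0 < a) {n : ℕ} (hn : n ≠ 0)
    (s : ℕ → ℤ) (t : ℝ≥0) {ψ : ℝ → ℝ} (hψ : Continuous ψ) {C : ℝ} (hC : ∀ u, |ψ u| ≤ C)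
    (hη : ∀ u v, |u - v| ≤ a⁻¹ → |ψ u - ψ v| ≤ η) :
    |(∫ x, ψ x * rescaledLocalTime a n s t x) -
      SkorokhodSpace.occupationIntegral ψ t (rescaledPath a n s)| ≤
      (t + 1) * η + C * (n : ℝ)⁻¹ := by
  have hn0 : (0 : ℝ) < n := by exact_mod_cast Nat.pos_of_ne_zero hn
  have hn1 : (1 : ℝ) ≤ n := by exact_mod_cast Nat.one_le_iff_ne_zero.2 hn
  have hη0 : 0 ≤ η := (abs_nonneg _).trans (hη 0 0 (by simpa using ha.le))
  set N := ⌊(n : ℝ≥0) * t⌋₊ with hN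
  have hN1 : (N : ℝ) ≤ n * t := by
    have := Nat.floor_le (a := (n : ℝ≥0) * t) zero_le
    exact_mod_cast this
  have hN2 : (n : ℝ) * t < N + 1 := by
    have := Nat.lt_floor_add_one ((n : ℝ≥0) * t)
    exact_mod_cast this
  have h1 : |(∫ x, ψ x * rescaledLocalTime a n s t x) -
      ∑ k ∈ Finset.range (N + 1), (n : ℝ)⁻¹ * ψ (a⁻¹ * s k)| ≤ (t + 1) * η := by
    rw [integral_mul_rescaledLocalTime a n s t hψ hC ha.ne', ← Finset.sum_sub_distrib]
    refine (Finset.abs_sum_le_sum_abs _ _).trans ?_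
    have : ∀ k ∈ Finset.range (N + 1), |(n : ℝ)⁻¹ * (a * ∫ x in cell a⁻¹ (s k), ψ x) -
        (n : ℝ)⁻¹ * ψ (a⁻¹ * s k)| ≤ (n : ℝ)⁻¹ * η := fun k _ => by
      rw [← mul_sub, abs_mul, abs_of_pos (inv_pos.2 hn0)]
      exact mul_le_mul_of_nonneg_left (abs_mul_integral_cell_sub_le ha hψ hC hη _)
        (inv_pos.2 hn0).le
    refine (Finset.sum_le_sum this).trans ?_
    rw [Finset.sum_const, Finset.card_range, nsmul_eq_mul, ← mul_assoc]
    refine mul_le_mul_of_nonneg_right ?_ hη0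
    rw [← div_eq_mul_inv, div_le_iff₀ hn0]
    push_cast
    nlinarith
  have h2 : |(∑ k ∈ Finset.range (N + 1), (n : ℝ)⁻¹ * ψ (a⁻¹ * s k)) -
      SkorokhodSpace.occupationIntegral ψ t (rescaledPath a n s)| ≤ C * (n : ℝ)⁻¹ := by
    have hI : ∀ b c : ℝ, IntervalIntegrable (fun u : ℝ => ψ (rescaledPath a n s u.toNNReal))
        volume b c := fun b c => by
      refine (intervalIntegrable_const (c := C)).mono_fun
        (hψ.measurable.comp (rescaledPath a n s).measurable_path).aestronglyMeasurable
        (ae_of_all _ fun u => (hC _).trans (le_abs_self C))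
    rw [sum_eq_integral_rescaledPath a hn s hψ hC, SkorokhodSpace.occupationIntegral,
      integral_Icc_eq_integral_Ioc, ← intervalIntegral.integral_of_le t.coe_nonneg,
      intervalIntegral.integral_interval_sub_left (hI _ _) (hI _ _)]
    have hC0 : 0 ≤ C := (abs_nonneg _).trans (hC 0)
    refine (intervalIntegral.norm_integral_le_of_norm_le_const (C := C)
      (f := fun u : ℝ => ψ (rescaledPath a n s u.toNNReal)) fun u _ => hC _).trans
      (mul_le_mul_of_nonneg_left ?_ hC0)
    rw [abs_of_nonneg]
    · rw [sub_le_iff_le_add, div_le_iff₀ hn0, add_mul, inv_mul_cancel₀ hn0.ne']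
      push_cast
      linarith
    · rw [sub_nonneg, le_div_iff₀ hn0]
      push_cast
      linarith
  calc _ ≤ _ := abs_sub_le _ (∑ k ∈ Finset.range (N + 1), (n : ℝ)⁻¹ * ψ (a⁻¹ * s k)) _
    _ ≤ _ := add_le_add h1 h2

/-- The bound is uniform in the path `s`, so the comparison is deterministic and needs no
independence or moments. -/
theorem eventually_abs_integral_mul_rescaledLocalTime_sub_le {a : ℕ → ℝ}
    (ha : Tendsto a atTop atTop) (t : ℝ≥0) {ψ : ℝ → ℝ} (hψ : UniformContinuous ψ) {C : ℝ}
    (hC : ∀ u, |ψ u| ≤ C) {ε : ℝ} (hε : 0 < ε) :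
    ∀ᶠ n in atTop, ∀ s : ℕ → ℤ, |(∫ x, ψ x * rescaledLocalTime (a n) n s t x) -
      SkorokhodSpace.occupationIntegral ψ t (rescaledPath (a n) n s)| ≤ ε := by
  have ht : (0 : ℝ) < t + 1 := by positivity
  set η : ℝ := ε / 2 / (t + 1) with hη
  have hη0 : 0 < η := by positivity
  obtain ⟨d, hd, hdψ⟩ := Metric.uniformContinuous_iff.1 hψ η hη0
  have e1 : ∀ᶠ n in atTop, (a n)⁻¹ < d := ha.inv_tendsto_atTop.eventually (gt_mem_nhds hd)
  have e2 : ∀ᶠ n : ℕ in atTop, C * (n : ℝ)⁻¹ < ε / 2 := by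
    have : Tendsto (fun n : ℕ => C * (n : ℝ)⁻¹) atTop (𝓝 (C * 0)) :=
      tendsto_inv_atTop_nhds_zero_nat.const_mul C
    rw [mul_zero] at this
    exact this.eventually (gt_mem_nhds (by positivity))
  filter_upwards [e1, e2, ha.eventually_gt_atTop 0, eventually_ne_atTop 0] with n h1 h2 h3 h4 s
  refine (abs_integral_mul_rescaledLocalTime_sub_le h3 h4 s t hψ.continuous hC (η := η)
    fun u v huv => (hdψ (huv.trans_lt h1)).le).trans ?_
  have : (t + 1) * η = ε / 2 := by rw [hη]; field_simp
  linarith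

/-! ### Step functions in `L^p` -/

theorem volume_cell_mesh_ne_top (J : ℕ) (j : ℤ) : volume (cell (mesh J) j) ≠ ∞ := by
  rw [volume_cell (mesh_pos J)]
  exact ENNReal.ofReal_ne_top

/-- The step function on `[-M, M)` with value `c j` on the `j`-th cell of mesh `1 / (J + 1)`. -/
noncomputable def cellStep (p : ℝ≥0∞) [Fact (1 ≤ p)] (M J : ℕ) (c : ℤ → ℝ) :
    Lp ℝ p (volume : Measure ℝ) :=
  ∑ j ∈ cellIndices M J,
    c j • indicatorConstLp p (measurableSet_cell (mesh J) j) (volume_cell_mesh_ne_top J j) (1 : ℝ)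

theorem coeFn_cellStep (p : ℝ≥0∞) [Fact (1 ≤ p)] (M J : ℕ) (c : ℤ → ℝ) :
    cellStep p M J c =ᵐ[volume]
      (Ico (-(M : ℝ)) M).indicator fun x => c ⌊(mesh J)⁻¹ * x⌋ := by
  have h1 : ∀ j, (c j • indicatorConstLp p (measurableSet_cell (mesh J) j)
      (volume_cell_mesh_ne_top J j) (1 : ℝ) : Lp ℝ p (volume : Measure ℝ)) =ᵐ[volume]
      (cell (mesh J) j).indicator fun _ => c j := fun j => by
    filter_upwards [Lp.coeFn_smul (c j) (indicatorConstLp p (measurableSet_cell (mesh J) j)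
      (volume_cell_mesh_ne_top J j) (1 : ℝ)), indicatorConstLp_coeFn (p := p)
      (hs := measurableSet_cell (mesh J) j) (hμs := volume_cell_mesh_ne_top J j) (c := (1 : ℝ))]
      with x hx hx'
    rw [hx, Pi.smul_apply, hx']
    by_cases h : x ∈ cell (mesh J) j <;> simp [h]
  filter_upwards [Lp.coeFn_finsetSum (cellIndices M J) fun j =>
    (c j • indicatorConstLp p (measurableSet_cell (mesh J) j) (volume_cell_mesh_ne_top J j)
      (1 : ℝ) : Lp ℝ p (volume : Measure ℝ)), ae_all_iff.2 h1] with x hx hx'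
  rw [cellStep, hx, Finset.sum_apply, Finset.sum_congr rfl fun j _ => hx' j]
  by_cases h : x ∈ Ico (-(M : ℝ)) M
  · rw [indicator_of_mem h, Finset.sum_eq_single_of_mem _ (floor_mem_cellIndices (J := J).2 h)]
    · rw [indicator_of_mem (mem_cell.2 rfl)]
    · intro j _ hj
      exact indicator_of_notMem (fun hx => hj (mem_cell.1 hx).symm) _
  · rw [indicator_of_notMem h]
    refine Finset.sum_eq_zero fun j hj => indicator_of_notMem (fun hx => h ?_) _
    rw [← mem_cell.1 hx] at hj
    exact floor_mem_cellIndices.1 hj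

theorem measurable_comp_floor (c : ℤ → ℝ) (δ : ℝ) : Measurable fun x : ℝ => c ⌊δ⁻¹ * x⌋ :=
  (measurable_of_countable c).comp (Int.measurable_floor.comp (measurable_const_mul δ⁻¹))

theorem enorm_eq_eLpNorm_restrict {p : ℝ≥0∞} [Fact (1 ≤ p)] {u : Lp ℝ p (volume : Measure ℝ)}
    {s : Set ℝ} (hs : MeasurableSet s) {f : ℝ → ℝ} (hu : u =ᵐ[volume] s.indicator f) :
    ‖u‖ₑ = eLpNorm f p (volume.restrict s) := by
  rw [Lp.enorm_def, eLpNorm_congr_ae hu, eLpNorm_indicator_eq_eLpNorm_restrict hs]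

theorem enorm_cellStep_sub_cellStep (p : ℝ≥0∞) [Fact (1 ≤ p)] (M J J' : ℕ) (c c' : ℤ → ℝ) :
    ‖cellStep p M J c - cellStep p M J' c'‖ₑ =
      eLpNorm (fun x => c ⌊(mesh J)⁻¹ * x⌋ - c' ⌊(mesh J')⁻¹ * x⌋) p
        (volume.restrict (Ico (-(M : ℝ)) M)) := by
  refine enorm_eq_eLpNorm_restrict measurableSet_Ico ?_
  filter_upwards [Lp.coeFn_sub (cellStep p M J c) (cellStep p M J' c'), coeFn_cellStep p M J c,
    coeFn_cellStep p M J' c'] with x h1 h2 h3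
  rw [h1, Pi.sub_apply, h2, h3]
  by_cases h : x ∈ Ico (-(M : ℝ)) M
  · simp only [indicator_of_mem h]
  · simp only [indicator_of_notMem h, sub_zero]

/-- Used with κ the containment of a path. If κ = 0, the term 1 - κ already dominates the truncated
norm; otherwise f vanishes outside the window and the global norm is the norm on the window. -/
theorem min_one_enorm_sub_cellStep_le {p : ℝ≥0∞} [Fact (1 ≤ p)] {M : ℕ} (J : ℕ) (c : ℤ → ℝ)
    {u : Lp ℝ p (volume : Measure ℝ)} {f : ℝ → ℝ} (hu : u =ᵐ[volume] f) {κ : ℝ}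
    (hκ : κ ≠ 0 → ∀ᵐ x, x ∉ Ico (-(M : ℝ)) M → f x = 0) :
    min 1 ‖u - cellStep p M J c‖ₑ ≤ ENNReal.ofReal (1 - κ) +
      min 1 (eLpNorm (fun x => f x - c ⌊(mesh J)⁻¹ * x⌋) p
        (volume.restrict (Ico (-(M : ℝ)) M))) := by
  rcases eq_or_ne κ 0 with rfl | h
  · refine (min_le_left _ _).trans ?_
    rw [sub_zero, ENNReal.ofReal_one]
    exact le_self_add
  · refine le_trans (le_of_eq ?_) le_add_self
    congr 1
    refine enorm_eq_eLpNorm_restrict measurableSet_Ico ?_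
    filter_upwards [Lp.coeFn_sub u (cellStep p M J c), hu, coeFn_cellStep p M J c, hκ h]
      with x h1 h2 h3 h4
    rw [h1, Pi.sub_apply, h2, h3]
    by_cases h : x ∈ Ico (-(M : ℝ)) M
    · simp only [indicator_of_mem h]
    · simp only [indicator_of_notMem h, h4 h, sub_zero]

/-! ### Linear combinations of local times -/

/-- The combination `∑ i, θ i * L_n(t i, ·)` of rescaled discrete local times. -/
noncomputable def combinedLocalTime {m : ℕ} (θ : Fin m → ℝ) (t : Fin m → ℝ≥0) (a : ℝ) (n : ℕ)
    (s : ℕ → ℤ) (x : ℝ) : ℝ :=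
  ∑ i, θ i * rescaledLocalTime a n s (t i) x

/-- The combination `∑ i, θ i * ∫_0^{t i} ψ (x s) ds` of occupation integrals. -/
noncomputable def combinedOccupation {m : ℕ} (θ : Fin m → ℝ) (t : Fin m → ℝ≥0) (ψ : ℝ → ℝ)
    (x : SkorokhodSpace) : ℝ :=
  ∑ i, θ i * SkorokhodSpace.occupationIntegral ψ (t i) x

/-- The step function on `[-M, M)` whose value on each cell is the combined occupation integral of
the kernel of the cell. -/
noncomputable def stepMap (p : ℝ≥0∞) [Fact (1 ≤ p)] {m : ℕ} (θ : Fin m → ℝ) (t : Fin m → ℝ≥0)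
    (M J : ℕ) (x : SkorokhodSpace) : Lp ℝ p (volume : Measure ℝ) :=
  cellStep p M J fun j => combinedOccupation θ t (cellKernel (mesh J) j) x

section

variable {m : ℕ} (θ : Fin m → ℝ) (t : Fin m → ℝ≥0)

theorem continuous_stepMap (p : ℝ≥0∞) [Fact (1 ≤ p)] (M J : ℕ) :
    Continuous (stepMap p θ t M J) := by
  have hc : ∀ j, Continuous fun x => combinedOccupation θ t (cellKernel (mesh J) j) x := fun j =>
    continuous_finsetSum _ fun i _ => continuous_const.mul
      (SkorokhodSpace.continuous_occupationIntegral (continuous_cellKernel _ _)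
        (abs_cellKernel_le (mesh_pos J) j) _)
  unfold stepMap cellStep
  refine continuous_finsetSum _ fun j _ => ?_
  exact (hc j).smul (continuous_const (y := indicatorConstLp p (measurableSet_cell (mesh J) j)
    (volume_cell_mesh_ne_top J j) (1 : ℝ)))

theorem memLp_combinedLocalTime (a : ℝ) (n : ℕ) (s : ℕ → ℤ) (p : ℝ≥0∞) :
    MemLp (combinedLocalTime θ t a n s) p :=
  memLp_finsetSum _ fun i _ => (memLp_rescaledLocalTime a n s (t i) p).const_mul (θ i)

theorem measurable_combinedLocalTime (a : ℝ) (n : ℕ) (s : ℕ → ℤ) :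
    Measurable (combinedLocalTime θ t a n s) :=
  Finset.measurable_fun_sum _ fun i _ => (measurable_rescaledLocalTime a n s (t i)).const_mul (θ i)

theorem measurable_comp_combinedLocalTime {Ω β : Type*} [MeasurableSpace Ω] [MeasurableSpace β]
    {S : ℕ → Ω → ℤ} (hS : ∀ k, Measurable (S k)) (a : ℝ) (n : ℕ) (p : ℝ≥0∞)
    (G : {f : ℝ → ℝ // MemLp f p} → β) :
    Measurable fun ω => G ⟨combinedLocalTime θ t a n fun k => S k ω,
      memLp_combinedLocalTime θ t a n _ p⟩ := by
  refine measurable_of_finitely_many hS (Finset.univ.sup fun i => ⌊(n : ℝ≥0) * t i⌋₊)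
    (G := fun s => G ⟨combinedLocalTime θ t a n s, memLp_combinedLocalTime θ t a n s p⟩)
    fun s s' h => ?_
  congr 2
  ext x
  refine Finset.sum_congr rfl fun i _ => ?_
  rw [rescaledLocalTime_congr fun k hk => h k
    (hk.trans (Finset.le_sup (f := fun i => ⌊(n : ℝ≥0) * t i⌋₊) (Finset.mem_univ i)))]

theorem eventually_abs_integral_mul_combinedLocalTime_sub_le {a : ℕ → ℝ}
    (ha : Tendsto a atTop atTop) {δ : ℝ} (hδ : 0 < δ) (j : ℤ) {ε : ℝ} (hε : 0 < ε) :
    ∀ᶠ n in atTop, ∀ s : ℕ → ℤ,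
      |(∫ x, cellKernel δ j x * combinedLocalTime θ t (a n) n s x) -
        combinedOccupation θ t (cellKernel δ j) (rescaledPath (a n) n s)| ≤ ε := by
  set R := ∑ i, |θ i| with hR
  have hR0 : 0 ≤ R := Finset.sum_nonneg fun _ _ => abs_nonneg _
  have h := eventually_all.2 fun i => eventually_abs_integral_mul_rescaledLocalTime_sub_le ha (t i)
    (uniformContinuous_cellKernel hδ j) (abs_cellKernel_le hδ j)
    (ε := ε / (R + 1)) (by positivity)
  filter_upwards [h] with n hn s
  have h1 : ∫ x, cellKernel δ j x * combinedLocalTime θ t (a n) n s x =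
      ∑ i, θ i * ∫ x, cellKernel δ j x * rescaledLocalTime (a n) n s (t i) x := by
    simp only [combinedLocalTime, Finset.mul_sum]
    rw [integral_finsetSum]
    · refine Finset.sum_congr rfl fun i _ => ?_
      rw [← integral_const_mul]
      refine integral_congr_ae (ae_of_all _ fun x => ?_)
      simp only
      ring
    · exact fun i _ => ((integrable_rescaledLocalTime _ _ _ _).const_mul (θ i)).cellKernel_mul hδ j
  rw [h1, combinedOccupation, ← Finset.sum_sub_distrib]
  refine (Finset.abs_sum_le_sum_abs _ _).trans ?_
  have h2 : ∀ i ∈ Finset.univ,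
      |θ i * (∫ x, cellKernel δ j x * rescaledLocalTime (a n) n s (t i) x) -
      θ i * SkorokhodSpace.occupationIntegral (cellKernel δ j) (t i) (rescaledPath (a n) n s)| ≤
      |θ i| * (ε / (R + 1)) := fun i _ => by
    rw [← mul_sub, abs_mul]
    exact mul_le_mul_of_nonneg_left (hn i s) (abs_nonneg _)
  refine (Finset.sum_le_sum h2).trans ?_
  rw [← Finset.sum_mul, ← hR, mul_div_assoc', div_le_iff₀ (by positivity)]
  nlinarith

theorem eventually_eLpNorm_cellAverage_sub_le {a : ℕ → ℝ} (ha : Tendsto a atTop atTop) (p : ℝ≥0∞)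
    (M J : ℕ) {ε : ℝ≥0∞} (hε : 0 < ε) :
    ∀ᶠ n in atTop, ∀ s : ℕ → ℤ,
      eLpNorm (fun x => cellAverage (mesh J) (combinedLocalTime θ t (a n) n s) x -
        combinedOccupation θ t (cellKernel (mesh J) ⌊(mesh J)⁻¹ * x⌋) (rescaledPath (a n) n s)) p
        (volume.restrict (Ico (-(M : ℝ)) M)) ≤ ε := by
  -- A pointwise bound e on the window gives an L^p bound K · e. Only finitely many cells meet the
  -- window, so the bound holds on all of them at once for large n.
  set K : ℝ≥0∞ := volume.restrict (Ico (-(M : ℝ)) M) univ ^ p.toReal⁻¹ with hK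
  have hK' : K ≠ ∞ := ENNReal.rpow_ne_top_of_nonneg (by positivity) (by simp)
  obtain ⟨e, he, heK⟩ : ∃ e : ℝ, 0 < e ∧ K * ENNReal.ofReal e ≤ ε := by
    rcases eq_or_ne ε ∞ with rfl | hε'
    · exact ⟨1, one_pos, le_top⟩
    · refine ⟨ε.toReal / (K.toReal + 1),
        div_pos (ENNReal.toReal_pos hε.ne' hε') (by positivity), ?_⟩
      rw [← ENNReal.ofReal_toReal hK', ← ENNReal.ofReal_mul (by positivity),
        ENNReal.toReal_ofReal (by positivity)]
      refine ENNReal.ofReal_le_of_le_toReal ?_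
      rw [mul_div_assoc', div_le_iff₀ (by positivity)]
      nlinarith [ENNReal.toReal_nonneg (a := ε), ENNReal.toReal_nonneg (a := K)]
  have h := (Finset.eventually_all (cellIndices M J)).2 fun j _ =>
    eventually_abs_integral_mul_combinedLocalTime_sub_le θ t ha (mesh_pos J) j he
  filter_upwards [h] with n hn s
  refine (eLpNorm_le_of_ae_bound (C := e) ?_).trans heK
  filter_upwards [ae_restrict_mem measurableSet_Ico] with x hx
  exact hn _ (floor_mem_cellIndices.2 hx) s

/-! ### The modulus of continuity in `L^p` -/

variable {Ω : Type*} [MeasurableSpace Ω] {P : Measure Ω} [IsProbabilityMeasure P]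

theorem lintegral_le_lintegral_rpow {p : ℝ≥0∞} (hp1 : 1 ≤ p) (hp : p ≠ ∞) {f : Ω → ℝ≥0∞}
    (hf : AEMeasurable f P) : ∫⁻ ω, f ω ∂P ≤ (∫⁻ ω, f ω ^ p.toReal ∂P) ^ (1 / p.toReal) := by
  have h := eLpNorm_le_eLpNorm_of_exponent_le hp1 hf.aestronglyMeasurable
  rw [eLpNorm_one_eq_lintegral_enorm,
    eLpNorm_eq_lintegral_rpow_enorm_toReal (one_pos.trans_le hp1).ne' hp] at h
  simpa only [enorm_eq_self] using h

theorem measurable_eLpNorm_prod {f : ℝ × Ω → ℝ} (hf : Measurable f) {p : ℝ≥0∞} (hp0 : p ≠ 0)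
    (hp : p ≠ ∞) (μ : Measure ℝ) [SFinite μ] :
    Measurable fun ω => eLpNorm (fun x => f (x, ω)) p μ := by
  simp only [eLpNorm_eq_lintegral_rpow_enorm_toReal hp0 hp]
  exact (Measurable.lintegral_prod_left' (hf.enorm.pow_const p.toReal)).pow_const _

/-- Jensen's inequality on the probability space, followed by Tonelli. -/
theorem lintegral_eLpNorm_le {f : ℝ × Ω → ℝ} (hf : Measurable f) {p : ℝ≥0∞} (hp1 : 1 ≤ p)
    (hp : p ≠ ∞) (μ : Measure ℝ) [SFinite μ] :
    ∫⁻ ω, eLpNorm (fun x => f (x, ω)) p μ ∂P ≤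
      (∫⁻ x, ∫⁻ ω, ‖f (x, ω)‖ₑ ^ p.toReal ∂P ∂μ) ^ (1 / p.toReal) := by
  have hp0 : 0 < p.toReal := ENNReal.toReal_pos (one_pos.trans_le hp1).ne' hp
  refine (lintegral_le_lintegral_rpow hp1 hp
    (measurable_eLpNorm_prod hf (one_pos.trans_le hp1).ne' hp μ).aemeasurable).trans ?_
  simp only [eLpNorm_eq_lintegral_rpow_enorm_toReal (one_pos.trans_le hp1).ne' hp, one_div,
    ENNReal.rpow_inv_rpow hp0.ne']
  rw [lintegral_lintegral_swap (f := fun x ω => ‖f (x, ω)‖ₑ ^ p.toReal)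
    (hf.enorm.pow_const _).aemeasurable]

theorem measurable_eLpNorm_rescaledLocalTime_sub {S : ℕ → Ω → ℤ} (hS : ∀ k, Measurable (S k))
    (a : ℝ) (n : ℕ) (u : ℝ≥0) (p : ℝ≥0∞) (δ : ℝ) (μ : Measure ℝ) :
    Measurable fun ω => eLpNorm (fun x => rescaledLocalTime a n (fun k => S k ω) u x -
      rescaledLocalTime a n (fun k => S k ω) u (gridFloor δ x)) p μ := by
  refine measurable_of_finitely_many hS ⌊(n : ℝ≥0) * u⌋₊ (G := fun s =>
    eLpNorm (fun x => rescaledLocalTime a n s u x -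
      rescaledLocalTime a n s u (gridFloor δ x)) p μ) fun s s' h => ?_
  simp only [rescaledLocalTime_congr h]

theorem eventually_lintegral_eLpNorm_sub_gridFloor_le {S : ℕ → Ω → ℤ}
    (hS : ∀ k, Measurable (S k)) {a : ℕ → ℝ} {p : ℝ≥0∞} (hp1 : 1 ≤ p) (hp : p ≠ ∞) {u : ℝ≥0}
    (h : ∀ M : ℝ, 0 < M →
      Tendsto (fun δ : ℝ => limsup (fun n : ℕ => ∫⁻ x in Icc (-M) M, ∫⁻ ω,
          ‖rescaledLocalTime (a n) n (fun k => S k ω) u x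
            - rescaledLocalTime (a n) n (fun k => S k ω) u (gridFloor δ x)‖ₑ ^ p.toReal ∂P) atTop)
        (𝓝[>] 0) (𝓝 0)) (M : ℕ) {ε : ℝ≥0∞} (hε : 0 < ε) :
    ∀ᶠ J in atTop, ∀ᶠ n in atTop,
      ∫⁻ ω, eLpNorm (fun x => rescaledLocalTime (a n) n (fun k => S k ω) u x -
        rescaledLocalTime (a n) n (fun k => S k ω) u (gridFloor (mesh J) x)) p
        (volume.restrict (Ico (-(M : ℝ)) M)) ∂P ≤ ε := by
  have hp0 : 0 < p.toReal := ENNReal.toReal_pos (one_pos.trans_le hp1).ne' hp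
  have hεp : 0 < ε ^ p.toReal := ENNReal.rpow_pos_of_nonneg hε hp0.le
  -- The window is enlarged to M + 1 because the hypothesis requires a positive bound and `M` may be
  -- 0.
  have h1 := ((h (M + 1) (by positivity)).comp tendsto_mesh).eventually (gt_mem_nhds hεp)
  refine h1.mono fun J hJ => ?_
  refine (eventually_lt_of_limsup_lt hJ).mono fun n hn => ?_
  have hm := measurable_rescaledLocalTime_prod hS (a n) n u measurable_id
  have hm' := measurable_rescaledLocalTime_prod hS (a n) n u (measurable_gridFloor (mesh J))
  have key := lintegral_eLpNorm_le (P := P) (hm.sub hm') hp1 hp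
    (volume.restrict (Ico (-(M : ℝ)) M))
  refine key.trans ?_
  rw [one_div, ENNReal.rpow_inv_le_iff hp0]
  refine le_trans ?_ (le_of_lt hn)
  exact lintegral_mono_set fun x hx => ⟨by linarith [hx.1], by linarith [hx.2]⟩

theorem eventually_lintegral_eLpNorm_sub_cellAverage_le {S : ℕ → Ω → ℤ}
    (hS : ∀ k, Measurable (S k)) {a : ℕ → ℝ} {p : ℝ≥0∞} (hp1 : 1 ≤ p) (hp : p ≠ ∞)
    (ht : ∀ i, 0 < t i)
    (h : ∀ u : ℝ≥0, 0 < u → ∀ M : ℝ, 0 < M →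
      Tendsto (fun δ : ℝ => limsup (fun n : ℕ => ∫⁻ x in Icc (-M) M, ∫⁻ ω,
          ‖rescaledLocalTime (a n) n (fun k => S k ω) u x
            - rescaledLocalTime (a n) n (fun k => S k ω) u (gridFloor δ x)‖ₑ ^ p.toReal ∂P) atTop)
        (𝓝[>] 0) (𝓝 0)) (M : ℕ) {ε : ℝ≥0∞} (hε : 0 < ε) :
    ∀ᶠ J in atTop, ∀ᶠ n in atTop,
      ∫⁻ ω, eLpNorm (fun x => combinedLocalTime θ t (a n) n (fun k => S k ω) x -
        cellAverage (mesh J) (combinedLocalTime θ t (a n) n fun k => S k ω) x) p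
        (volume.restrict (Ico (-(M : ℝ)) M)) ∂P ≤ ε := by
  set μ := volume.restrict (Ico (-(M : ℝ)) M) with hμ
  set R : ℝ≥0∞ := ∑ i, ‖θ i‖ₑ * 3 with hR
  have hRtop : R ≠ ∞ := ENNReal.sum_ne_top.2 fun i _ =>
    ENNReal.mul_ne_top enorm_ne_top (by simp)
  have hε' : 0 < ε / (R + 1) := ENNReal.div_pos hε.ne' (by simp [hRtop])
  filter_upwards [eventually_all.2 fun i => eventually_lintegral_eLpNorm_sub_gridFloor_le hS hp1 hp
    (h (t i) (ht i)) M hε'] with J hJ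
  filter_upwards [eventually_all.2 hJ] with n hn
  have hpt : ∀ s : ℕ → ℤ, eLpNorm (fun x => combinedLocalTime θ t (a n) n s x -
      cellAverage (mesh J) (combinedLocalTime θ t (a n) n s) x) p μ ≤
      ∑ i, ‖θ i‖ₑ * 3 * eLpNorm (fun x => rescaledLocalTime (a n) n s (t i) x -
        rescaledLocalTime (a n) n s (t i) (gridFloor (mesh J) x)) p μ := by
    intro s
    have h1 : (fun x => combinedLocalTime θ t (a n) n s x -
        cellAverage (mesh J) (combinedLocalTime θ t (a n) n s) x) =
        ∑ i, θ i • fun x => rescaledLocalTime (a n) n s (t i) x -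
          cellAverage (mesh J) (rescaledLocalTime (a n) n s (t i)) x := by
      ext x
      have := cellAverage_sum Finset.univ (mesh_pos J) θ
        (f := fun i => rescaledLocalTime (a n) n s (t i))
        (fun i _ => integrable_rescaledLocalTime _ _ _ _) x
      rw [show combinedLocalTime θ t (a n) n s = fun y => ∑ i, θ i *
        rescaledLocalTime (a n) n s (t i) y from rfl, this]
      simp only [Finset.sum_apply, Pi.smul_apply, smul_eq_mul, mul_sub, Finset.sum_sub_distrib]
    rw [h1]
    refine (eLpNorm_sum_le (fun i _ => (((measurable_rescaledLocalTime _ _ _ _).sub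
      (measurable_cellAverage _ _)).const_smul (θ i)).aestronglyMeasurable) hp1).trans ?_
    refine Finset.sum_le_sum fun i _ => ?_
    rw [eLpNorm_const_smul, mul_assoc]
    gcongr
    exact eLpNorm_sub_cellAverage_le M J (integrable_rescaledLocalTime _ _ _ _)
      (measurable_rescaledLocalTime _ _ _ _) hp1 hp
  refine (lintegral_mono fun ω => hpt _).trans ?_
  rw [lintegral_finsetSum _ fun i _ => (measurable_eLpNorm_rescaledLocalTime_sub hS _ _ _ _ _
    _).const_mul _]
  calc _ ≤ ∑ i, ‖θ i‖ₑ * 3 * (ε / (R + 1)) := by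
        refine Finset.sum_le_sum fun i _ => ?_
        rw [lintegral_const_mul _ (measurable_eLpNorm_rescaledLocalTime_sub hS _ _ _ _ _ _)]
        gcongr
        exact hn i
    _ = R * (ε / (R + 1)) := by rw [← Finset.sum_mul]
    _ ≤ (R + 1) * (ε / (R + 1)) := by gcongr; exact le_self_add
    _ ≤ ε := ENNReal.mul_div_le

end

/-! ### Occupation densities -/

section OccupationDensity

variable {x : SkorokhodSpace} {u : ℝ≥0} {ℓ : ℝ → ℝ}

theorem integrable_of_occupation (hm : Measurable ℓ) (h0 : ∀ y, 0 ≤ ℓ y)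
    (h : ∀ B : Set ℝ, MeasurableSet B →
      volume {s : ℝ | 0 ≤ s ∧ s ≤ (u : ℝ) ∧ x s.toNNReal ∈ B} = ∫⁻ y in B, ENNReal.ofReal (ℓ y)) :
    Integrable ℓ := by
  refine ⟨hm.aestronglyMeasurable, ?_⟩
  rw [hasFiniteIntegral_iff_ofReal (ae_of_all _ h0)]
  have h1 := h univ MeasurableSet.univ
  rw [Measure.restrict_univ] at h1
  rw [← h1]
  refine (measure_mono (t := Icc (0 : ℝ) u) fun s hs => ⟨hs.1, hs.2.1⟩).trans_lt ?_
  simp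

/-- The identity on sets says that the image of Lebesgue measure on [0,u] under the path has density
`ℓ`; the claim is the change of variables for this image. -/
theorem occupationIntegral_eq_integral_mul (hm : Measurable ℓ) (h0 : ∀ y, 0 ≤ ℓ y)
    (h : ∀ B : Set ℝ, MeasurableSet B →
      volume {s : ℝ | 0 ≤ s ∧ s ≤ (u : ℝ) ∧ x s.toNNReal ∈ B} = ∫⁻ y in B, ENNReal.ofReal (ℓ y))
    {ψ : ℝ → ℝ} (hψ : Continuous ψ) :
    SkorokhodSpace.occupationIntegral ψ u x = ∫ y, ψ y * ℓ y := by
  have hμ : (volume.restrict (Icc (0 : ℝ) u)).map (fun s : ℝ => x s.toNNReal) =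
      volume.withDensity fun y => ENNReal.ofReal (ℓ y) := by
    ext B hB
    rw [Measure.map_apply x.measurable_path hB, withDensity_apply _ hB, ← h B hB,
      Measure.restrict_apply (x.measurable_path hB)]
    congr 1
    ext s
    exact ⟨fun hs => ⟨hs.2.1, hs.2.2, hs.1⟩, fun hs => ⟨hs.2.2, hs.1, hs.2.1⟩⟩
  have h1 := integral_map (μ := volume.restrict (Icc (0 : ℝ) u)) x.measurable_path.aemeasurable
    (f := ψ) hψ.aestronglyMeasurable
  rw [SkorokhodSpace.occupationIntegral, ← h1, hμ, integral_withDensity_eq_integral_toReal_smul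
    hm.ennreal_ofReal (ae_of_all _ fun _ => ENNReal.ofReal_lt_top)]
  refine integral_congr_ae (ae_of_all _ fun y => ?_)
  simp only [ENNReal.toReal_ofReal (h0 y), smul_eq_mul, mul_comm]

theorem ae_eq_zero_of_occupation (hm : Measurable ℓ) (h0 : ∀ y, 0 ≤ ℓ y)
    (h : ∀ B : Set ℝ, MeasurableSet B →
      volume {s : ℝ | 0 ≤ s ∧ s ≤ (u : ℝ) ∧ x s.toNNReal ∈ B} = ∫⁻ y in B, ENNReal.ofReal (ℓ y))
    {B : Set ℝ} (hB : MeasurableSet B) (hx : ∀ r ≤ u, x r ∈ B) : ∀ᵐ y, y ∉ B → ℓ y = 0 := by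
  have h1 := h Bᶜ hB.compl
  have h2 : {s : ℝ | 0 ≤ s ∧ s ≤ (u : ℝ) ∧ x s.toNNReal ∈ Bᶜ} = ∅ := by
    refine eq_empty_iff_forall_notMem.2 fun s hs => hs.2.2 (hx _ ?_)
    exact Real.toNNReal_le_iff_le_coe.2 hs.2.1
  rw [h2, measure_empty, eq_comm, lintegral_eq_zero_iff hm.ennreal_ofReal,
    Filter.EventuallyEq, ae_restrict_iff' hB.compl] at h1
  filter_upwards [h1] with y hy hyB
  exact le_antisymm (ENNReal.ofReal_eq_zero.1 (hy hyB)) (h0 y)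

end OccupationDensity

/-! ### Measurability of `L^p`-valued maps -/

/-- By separability an open set is a countable union of balls with centres in a dense sequence and
rational radii. -/
theorem measurable_of_measurable_edist {Ω E : Type*} [MeasurableSpace Ω] [PseudoMetricSpace E]
    [SecondCountableTopology E] [MeasurableSpace E] [BorelSpace E] {f : Ω → E}
    (h : ∀ g : E, Measurable fun ω => edist (f ω) g) : Measurable f := by
  refine measurable_of_isOpen fun U hU => ?_
  rcases isEmpty_or_nonempty E with hE | hE
  · rw [eq_empty_of_isEmpty U]
    exact MeasurableSet.empty
  let d := TopologicalSpace.denseSeq E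
  have hU' : f ⁻¹' U = ⋃ (k : ℕ) (r : ℚ) (_ : Metric.ball (d k) r ⊆ U),
      {ω | edist (f ω) (d k) < ENNReal.ofReal r} := by
    ext ω
    simp only [mem_preimage, mem_iUnion, exists_prop, mem_ofPred_eq]
    constructor
    · intro hω
      obtain ⟨ε, hε, hεU⟩ := Metric.isOpen_iff.1 hU _ hω
      obtain ⟨r, hr0, hrε⟩ := exists_rat_btwn (half_pos hε)
      obtain ⟨k, hk⟩ := (TopologicalSpace.denseRange_denseSeq E).exists_dist_lt (f ω) hr0
      refine ⟨k, r, fun y hy => hεU ?_, ?_⟩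
      · rw [Metric.mem_ball] at hy ⊢
        have := dist_triangle_right y (f ω) (d k)
        linarith
      · rwa [edist_dist, ENNReal.ofReal_lt_ofReal_iff hr0]
    · rintro ⟨k, r, hr, hω⟩
      refine hr ?_
      rw [edist_dist] at hω
      have hr0 : (0 : ℝ) < r := by
        by_contra! h0
        rw [ENNReal.ofReal_of_nonpos h0] at hω
        exact not_lt_bot hω
      exact (ENNReal.ofReal_lt_ofReal_iff hr0).1 hω
  rw [hU']
  exact MeasurableSet.iUnion fun k => MeasurableSet.iUnion fun r => MeasurableSet.iUnion fun _ =>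
    measurableSet_lt (h (d k)) measurable_const

open Classical in
/-- The class in `L^p` of `f`, or `0` if `f` is not in `L^p`. -/
noncomputable def toLpOrZero (p : ℝ≥0∞) [Fact (1 ≤ p)] (f : ℝ → ℝ) :
    Lp ℝ p (volume : Measure ℝ) :=
  if h : MemLp f p then h.toLp f else 0

theorem coeFn_toLpOrZero {p : ℝ≥0∞} [Fact (1 ≤ p)] {f : ℝ → ℝ} (hf : MemLp f p) :
    toLpOrZero p f =ᵐ[volume] f := by
  rw [toLpOrZero, dif_pos hf]
  exact hf.coeFn_toLp

/-- The distance to a fixed g is an L^p norm in x of a jointly measurable function where the section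
is in L^p, and a constant elsewhere. -/
theorem measurable_toLpOrZero {Ω : Type*} [MeasurableSpace Ω] {p : ℝ≥0∞} [hp1 : Fact (1 ≤ p)]
    (hp : p ≠ ∞) {f : ℝ × Ω → ℝ} (hf : Measurable f) :
    Measurable fun ω => toLpOrZero p fun x => f (x, ω) := by
  have hp0 : p ≠ 0 := (one_pos.trans_le hp1.out).ne'
  have : Fact (p ≠ ∞) := ⟨hp⟩
  have hmem : ∀ ω, MemLp (fun x => f (x, ω)) p ↔ eLpNorm (fun x => f (x, ω)) p volume < ∞ :=
    fun ω => ⟨fun h => h.2, fun h => ⟨(hf.comp measurable_prodMk_right).aestronglyMeasurable, h⟩⟩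
  refine measurable_of_measurable_edist fun g => ?_
  have hg := (Lp.stronglyMeasurable g).measurable
  classical
  set A : Set Ω := {ω | eLpNorm (fun x => f (x, ω)) p volume < ∞} with hA
  have hE : MeasurableSet A :=
    measurableSet_lt (measurable_eLpNorm_prod hf hp0 hp _) measurable_const
  have h1 : (fun ω => edist (toLpOrZero p fun x => f (x, ω)) g) = A.piecewise
      (fun ω => eLpNorm (fun x => f (x, ω) - g x) p volume) fun _ => edist 0 g := by
    ext ω
    by_cases hω : ω ∈ A
    · rw [piecewise_eq_of_mem A _ _ hω, Lp.edist_def]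
      refine eLpNorm_congr_ae ?_
      filter_upwards [coeFn_toLpOrZero ((hmem ω).2 hω)] with x hx
      rw [Pi.sub_apply, hx]
    · rw [piecewise_eq_of_notMem A _ _ hω, toLpOrZero, dif_neg (mt (hmem ω).1 hω)]
  rw [h1]
  exact Measurable.piecewise hE
    (measurable_eLpNorm_prod (hf.sub (hg.comp measurable_fst)) hp0 hp _) measurable_const

/-! ### Passage to the limit -/

theorem tendsto_lintegral_ofReal_comp {Ω Ω' D : Type*} [MeasurableSpace Ω] [MeasurableSpace Ω']
    {P : Measure Ω} [IsProbabilityMeasure P] {P' : Measure Ω'} [IsProbabilityMeasure P']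
    [TopologicalSpace D] [MeasurableSpace D] [BorelSpace D] {Yn : ℕ → Ω → D} {Y : Ω' → D}
    (hY : TendstoInDistribution Yn atTop Y (fun _ => P) P') {g : D → ℝ} (hg : Continuous g)
    (h0 : ∀ x, 0 ≤ g x) (h1 : ∀ x, g x ≤ 1) :
    Tendsto (fun n => ∫⁻ ω, ENNReal.ofReal (g (Yn n ω)) ∂P) atTop
      (𝓝 (∫⁻ ω, ENNReal.ofReal (g (Y ω)) ∂P')) := by
  have hb : ∀ x, ‖g x‖ ≤ 1 := fun x => by
    rw [Real.norm_eq_abs, abs_of_nonneg (h0 x)]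
    exact h1 x
  have h := ProbabilityMeasure.tendsto_iff_forall_integral_tendsto.1 hY.tendsto
    (BoundedContinuousFunction.ofNormedAddCommGroup g hg 1 hb)
  simp only [ProbabilityMeasure.coe_mk, BoundedContinuousFunction.coe_ofNormedAddCommGroup] at h
  simp_rw [integral_map (hY.forall_aemeasurable _) hg.measurable.aestronglyMeasurable] at h
  rw [integral_map hY.aemeasurable_limit hg.measurable.aestronglyMeasurable] at h
  have hn : ∀ n, ENNReal.ofReal (∫ ω, g (Yn n ω) ∂P) = ∫⁻ ω, ENNReal.ofReal (g (Yn n ω)) ∂P :=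
    fun n => ofReal_integral_eq_lintegral_ofReal (Integrable.of_bound
      (hg.measurable.comp_aemeasurable
      (hY.forall_aemeasurable n)).aestronglyMeasurable 1 (ae_of_all _ fun _ => hb _))
      (ae_of_all _ fun _ => h0 _)
  have hl : ENNReal.ofReal (∫ ω, g (Y ω) ∂P') = ∫⁻ ω, ENNReal.ofReal (g (Y ω)) ∂P' :=
    ofReal_integral_eq_lintegral_ofReal (Integrable.of_bound (hg.measurable.comp_aemeasurable
      hY.aemeasurable_limit).aestronglyMeasurable 1 (ae_of_all _ fun _ => hb _))
      (ae_of_all _ fun _ => h0 _)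
  have h' := ENNReal.tendsto_ofReal h
  rw [hl] at h'
  simpa only [hn] using h'

theorem ofReal_min_one_norm {E : Type*} [SeminormedAddCommGroup E] (u : E) :
    ENNReal.ofReal (min 1 ‖u‖) = min 1 ‖u‖ₑ := by
  rw [ENNReal.ofReal_min, ENNReal.ofReal_one, ofReal_norm]

theorem eLpNorm_sub_le_add {p : ℝ≥0∞} (hp1 : 1 ≤ p) {μ : Measure ℝ} {f g h : ℝ → ℝ}
    (hf : Measurable f) (hg : Measurable g) (hh : Measurable h) :
    eLpNorm (fun x => f x - h x) p μ ≤
      eLpNorm (fun x => f x - g x) p μ + eLpNorm (fun x => g x - h x) p μ := by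
  have : (fun x => f x - h x) = (fun x => f x - g x) + fun x => g x - h x := by
    ext x
    simp
  rw [this]
  exact eLpNorm_add_le (hf.sub hg).aestronglyMeasurable (hg.sub hh).aestronglyMeasurable hp1

theorem eLpNorm_fun_sub_comm {p : ℝ≥0∞} {μ : Measure ℝ} (f g : ℝ → ℝ) :
    eLpNorm (fun x => f x - g x) p μ = eLpNorm (fun x => g x - f x) p μ :=
  eLpNorm_sub_comm f g p μ

/-- A càdlàg path is bounded on [0, T+1], so its containment is 1 for large M; dominated convergence
does the rest. -/
theorem exists_lintegral_one_sub_containment_lt {Ω' : Type*} [MeasurableSpace Ω']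
    {P' : Measure Ω'} [IsProbabilityMeasure P'] {Y : Ω' → SkorokhodSpace} (hY : AEMeasurable Y P')
    (T : ℝ≥0) {ε : ℝ≥0∞} (hε : 0 < ε) :
    ∃ M : ℕ, ∫⁻ ω, ENNReal.ofReal (1 - SkorokhodSpace.containment M T (Y ω)) ∂P' < ε := by
  have h : Tendsto (fun M : ℕ =>
      ∫⁻ ω, ENNReal.ofReal (1 - SkorokhodSpace.containment M T (Y ω)) ∂P')
      atTop (𝓝 (∫⁻ _, 0 ∂P')) := by
    refine tendsto_lintegral_of_dominated_convergence' (fun _ => 1) (fun M => ?_) (fun M => ?_)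
      (by simp) (ae_of_all _ fun ω => ?_)
    · exact ((SkorokhodSpace.continuous_containment M T).measurable.comp_aemeasurable
        hY).const_sub 1 |>.ennreal_ofReal
    · refine ae_of_all _ fun ω => ENNReal.ofReal_le_one.2 ?_
      linarith [SkorokhodSpace.containment_nonneg M T (Y ω)]
    · obtain ⟨C, hC⟩ := (Y ω).2.exists_abs_le (T + 1)
      refine tendsto_const_nhds.congr' ?_
      filter_upwards [tendsto_natCast_atTop_atTop.eventually_ge_atTop C] with M hM
      rw [SkorokhodSpace.containment_eq_one fun r hr => (hC r hr).trans hM, sub_self,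
        ENNReal.ofReal_zero]
  rw [lintegral_zero] at h
  exact (h.eventually (gt_mem_nhds hε)).exists

/-! ### The limiting local time as a limit of its cell averages -/

section Limit

variable {Ω Ω' : Type*} [MeasurableSpace Ω] [MeasurableSpace Ω'] {P : Measure Ω}
  {P' : Measure Ω'} {S : ℕ → Ω → ℤ} {a : ℕ → ℝ} {Y : Ω' → SkorokhodSpace}
  {L : ℝ≥0 → ℝ → Ω' → ℝ} {p : ℝ≥0∞} {m : ℕ} {θ : Fin m → ℝ} {t : Fin m → ℝ≥0}

theorem measurable_eLpNorm_combinedLocalTime_sub (hS : ∀ k, Measurable (S k)) (b : ℝ) (n J : ℕ)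
    (μ : Measure ℝ) :
    Measurable fun ω => eLpNorm (fun x => combinedLocalTime θ t b n (fun k => S k ω) x -
      cellAverage (mesh J) (combinedLocalTime θ t b n fun k => S k ω) x) p μ :=
  measurable_comp_combinedLocalTime θ t hS b n p
    fun f => eLpNorm (fun x => f.1 x - cellAverage (mesh J) f.1 x) p μ

/-- Almost surely, the local time is an occupation density, at all the times `t i`. -/
theorem IsLocalTime.ae_forall_occupation (hL : IsLocalTime P' Y L) (t : Fin m → ℝ≥0) :
    ∀ᵐ ω ∂P', ∀ i, ∀ B : Set ℝ, MeasurableSet B →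
      volume {s : ℝ | 0 ≤ s ∧ s ≤ (t i : ℝ) ∧ Y ω s.toNNReal ∈ B} =
        ∫⁻ x in B, ENNReal.ofReal (L (t i) x ω) :=
  ae_all_iff.2 fun i => hL.occupation (t i)

theorem IsLocalTime.measurable_section (hL : IsLocalTime P' Y L) (u : ℝ≥0) (ω : Ω') :
    Measurable fun x => L u x ω :=
  (hL.measurable u).comp measurable_prodMk_right

theorem IsLocalTime.measurable_combination (hL : IsLocalTime P' Y L) (θ : Fin m → ℝ)
    (t : Fin m → ℝ≥0) : Measurable fun z : ℝ × Ω' => ∑ i, θ i * L (t i) z.1 z.2 :=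
  Finset.measurable_fun_sum _ fun i _ => (hL.measurable (t i)).const_mul (θ i)

theorem IsLocalTime.ae_integrable_combination (hL : IsLocalTime P' Y L) (θ : Fin m → ℝ)
    (t : Fin m → ℝ≥0) : ∀ᵐ ω ∂P', Integrable fun x => ∑ i, θ i * L (t i) x ω := by
  filter_upwards [hL.ae_forall_occupation t] with ω hω
  exact integrable_finsetSum _ fun i _ => (integrable_of_occupation (hL.measurable_section _ _)
    (fun y => hL.nonneg _ _ _) (hω i)).const_mul (θ i)

theorem IsLocalTime.ae_cellAverage_eq (hL : IsLocalTime P' Y L) (θ : Fin m → ℝ)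
    (t : Fin m → ℝ≥0) : ∀ᵐ ω ∂P', ∀ J x,
      cellAverage (mesh J) (fun y => ∑ i, θ i * L (t i) y ω) x =
        combinedOccupation θ t (cellKernel (mesh J) ⌊(mesh J)⁻¹ * x⌋) (Y ω) := by
  filter_upwards [hL.ae_forall_occupation t] with ω hω J x
  rw [cellAverage_sum Finset.univ (mesh_pos J) θ (f := fun i y => L (t i) y ω) fun i _ =>
    integrable_of_occupation (hL.measurable_section _ _) (fun y => hL.nonneg _ _ _) (hω i)]
  refine Finset.sum_congr rfl fun i _ => ?_
  rw [occupationIntegral_eq_integral_mul (hL.measurable_section _ _) (fun y => hL.nonneg _ _ _)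
    (hω i) (continuous_cellKernel _ _), cellAverage]

theorem IsLocalTime.ae_combination_eq_zero (hL : IsLocalTime P' Y L) (θ : Fin m → ℝ)
    (t : Fin m → ℝ≥0) : ∀ᵐ ω ∂P', ∀ M : ℕ,
      (∀ i, ∀ r ≤ t i, |Y ω r| < (M : ℝ) + 1) →
        ∀ᵐ x, x ∉ Ico (-((M + 2 : ℕ) : ℝ)) (M + 2 : ℕ) → ∑ i, θ i * L (t i) x ω = 0 := by
  filter_upwards [hL.ae_forall_occupation t] with ω hω M hM
  have h : ∀ i, ∀ᵐ x, x ∉ Ico (-((M + 2 : ℕ) : ℝ)) (M + 2 : ℕ) → L (t i) x ω = 0 := fun i =>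
    ae_eq_zero_of_occupation (hL.measurable_section _ _) (fun y => hL.nonneg _ _ _) (hω i)
      measurableSet_Ico fun r hr => by
        have := abs_lt.1 (hM i r hr)
        push_cast
        exact ⟨by linarith [this.1], by linarith [this.2]⟩
  filter_upwards [ae_all_iff.2 h] with x hx hxM
  exact Finset.sum_eq_zero fun i _ => by rw [hx i hxM, mul_zero]

/-- Cell averages have finite norm on a window. Where the local norm of the combination is infinite,
its distance to them is infinite and the truncated distance equals 1, so this event has probability
at most every ε > 0. Boundedness of the path up to the last time reduces the global norm to a local
one. -/
theorem ae_memLp_combination [hp1 : Fact (1 ≤ p)] (hp : p ≠ ∞) (hL : IsLocalTime P' Y L)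
    (h : ∀ M : ℕ, ∀ ε : ℝ≥0∞, 0 < ε → ∀ᶠ J in atTop,
      ∫⁻ ω, min 1 (eLpNorm (fun x => (∑ i, θ i * L (t i) x ω) -
        cellAverage (mesh J) (fun y => ∑ i, θ i * L (t i) y ω) x) p
        (volume.restrict (Ico (-(M : ℝ)) M))) ∂P' ≤ ε) :
    ∀ᵐ ω ∂P', MemLp (fun x => ∑ i, θ i * L (t i) x ω) p := by
  have hp0 : p ≠ 0 := (one_pos.trans_le hp1.out).ne'
  have hV := hL.measurable_combination θ t
  have hVω : ∀ ω, Measurable fun x => ∑ i, θ i * L (t i) x ω := fun ω =>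
    hV.comp measurable_prodMk_right
  have hloc : ∀ M : ℕ, ∀ᵐ ω ∂P', eLpNorm (fun x => ∑ i, θ i * L (t i) x ω) p
      (volume.restrict (Ico (-(M : ℝ)) M)) < ∞ := by
    intro M
    set μ := volume.restrict (Ico (-(M : ℝ)) M) with hμ
    set A : Set Ω' := {ω | eLpNorm (fun x => ∑ i, θ i * L (t i) x ω) p μ = ∞} with hA
    have hAm : MeasurableSet A :=
      (measurable_eLpNorm_prod hV hp0 hp μ) (measurableSet_singleton ∞)
    suffices hA0 : P' A = 0 by
      filter_upwards [measure_eq_zero_iff_ae_notMem.1 hA0] with ω hω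
      exact lt_top_iff_ne_top.2 hω
    refine le_antisymm (le_of_forall_pos_le_add fun ε hε => ?_) zero_le
    rw [zero_add]
    obtain ⟨J, hJ⟩ := (h M ε hε).exists
    refine le_trans ?_ hJ
    rw [← lintegral_indicator_one hAm]
    refine lintegral_mono_ae ?_
    filter_upwards [hL.ae_cellAverage_eq θ t] with ω hω
    by_cases hωA : ω ∈ A
    · rw [indicator_of_mem hωA, Pi.one_apply]
      refine le_min le_rfl ?_
      have h1 : eLpNorm (cellAverage (mesh J) fun y => ∑ i, θ i * L (t i) y ω) p μ < ∞ := by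
        have h2 := coeFn_cellStep p M J fun j => combinedOccupation θ t (cellKernel (mesh J) j)
          (Y ω)
        rw [show cellAverage (mesh J) (fun y => ∑ i, θ i * L (t i) y ω) = fun x => _ from
          funext (hω J), ← enorm_eq_eLpNorm_restrict measurableSet_Ico h2]
        exact enorm_lt_top
      by_contra! hlt
      have h3 := eLpNorm_add_le (p := p) (μ := μ)
        (f := fun x => (∑ i, θ i * L (t i) x ω) -
          cellAverage (mesh J) (fun y => ∑ i, θ i * L (t i) y ω) x)
        (g := cellAverage (mesh J) fun y => ∑ i, θ i * L (t i) y ω)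
        ((hVω ω).sub (measurable_cellAverage _ _)).aestronglyMeasurable
        (measurable_cellAverage _ _).aestronglyMeasurable hp1.out
      have h4 : ((fun x => (∑ i, θ i * L (t i) x ω) -
          cellAverage (mesh J) (fun y => ∑ i, θ i * L (t i) y ω) x) +
          cellAverage (mesh J) fun y => ∑ i, θ i * L (t i) y ω) =
          fun x => ∑ i, θ i * L (t i) x ω := by
        ext x
        simp
      rw [h4] at h3
      exact absurd hωA (h3.trans_lt (ENNReal.add_lt_top.2
        ⟨hlt.trans ENNReal.one_lt_top, h1⟩)).ne
    · rw [indicator_of_notMem hωA]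
      exact zero_le
  filter_upwards [ae_all_iff.2 hloc, hL.ae_combination_eq_zero θ t] with ω hω hω'
  obtain ⟨C, hC⟩ := (Y ω).2.exists_abs_le (Finset.univ.sup t)
  obtain ⟨M, hM⟩ := exists_nat_ge C
  have h0 := hω' M fun i r hr => lt_of_le_of_lt
    ((hC r (hr.trans (Finset.le_sup (Finset.mem_univ i)))).trans hM) (lt_add_one _)
  refine ⟨(hVω ω).aestronglyMeasurable, ?_⟩
  have h1 : (fun x => ∑ i, θ i * L (t i) x ω) =ᵐ[volume]
      (Ico (-((M + 2 : ℕ) : ℝ)) (M + 2 : ℕ)).indicator fun x => ∑ i, θ i * L (t i) x ω := by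
    filter_upwards [h0] with x hx
    by_cases hxI : x ∈ Ico (-((M + 2 : ℕ) : ℝ)) (M + 2 : ℕ)
    · rw [indicator_of_mem hxI]
    · rw [indicator_of_notMem hxI, hx hxI]
  rw [eLpNorm_congr_ae h1, eLpNorm_indicator_eq_eLpNorm_restrict measurableSet_Ico]
  exact hω (M + 2)

variable [IsProbabilityMeasure P] [IsProbabilityMeasure P'] [hp1 : Fact (1 ≤ p)]

/-- If the rescaled discrete local times are close to their cell averages, the step functions
associated with the limit process at two fine meshes are close to each other. -/
theorem lintegral_stepMap_sub_stepMap_le (hS : ∀ k, Measurable (S k))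
    (ha : Tendsto a atTop atTop)
    (hY : TendstoInDistribution (fun (n : ℕ) (ω : Ω) => rescaledPath (a n) n fun k => S k ω)
      atTop Y (fun _ => P) P') {M J J' : ℕ} {ε : ℝ≥0∞} (hε : 0 < ε)
    (hJ : ∀ᶠ n in atTop,
      ∫⁻ ω, eLpNorm (fun x => combinedLocalTime θ t (a n) n (fun k => S k ω) x -
        cellAverage (mesh J) (combinedLocalTime θ t (a n) n fun k => S k ω) x) p
        (volume.restrict (Ico (-(M : ℝ)) M)) ∂P ≤ ε)
    (hJ' : ∀ᶠ n in atTop,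
      ∫⁻ ω, eLpNorm (fun x => combinedLocalTime θ t (a n) n (fun k => S k ω) x -
        cellAverage (mesh J') (combinedLocalTime θ t (a n) n fun k => S k ω) x) p
        (volume.restrict (Ico (-(M : ℝ)) M)) ∂P ≤ ε) :
    ∫⁻ ω, min 1 ‖stepMap p θ t M J (Y ω) - stepMap p θ t M J' (Y ω)‖ₑ ∂P' ≤ 4 * ε := by
  set μ := volume.restrict (Ico (-(M : ℝ)) M) with hμ
  -- Truncation at 1 makes this a bounded continuous functional of the path, so a bound along the
  -- rescaled paths passes to `Y`.
  have hg : Continuous fun x => min 1 ‖stepMap p θ t M J x - stepMap p θ t M J' x‖ :=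
    continuous_const.min ((continuous_stepMap θ t p M J).sub (continuous_stepMap θ t p M J')).norm
  have hlim := tendsto_lintegral_ofReal_comp hY hg (fun x => le_min zero_le_one (norm_nonneg _))
    fun x => min_le_left _ _
  simp only [ofReal_min_one_norm] at hlim
  refine le_of_tendsto hlim ?_
  filter_upwards [hJ, hJ', eventually_eLpNorm_cellAverage_sub_le θ t ha p M J hε,
    eventually_eLpNorm_cellAverage_sub_le θ t ha p M J' hε] with n h1 h2 h3 h4
  -- The chain is step map, cell average at J, local time, cell average at J', step map: two
  -- deterministic errors at the ends and two modulus errors in the middle, whence 4ε.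
  have hpt : ∀ ω, min 1 ‖stepMap p θ t M J (rescaledPath (a n) n fun k => S k ω) -
      stepMap p θ t M J' (rescaledPath (a n) n fun k => S k ω)‖ₑ ≤
      (ε + eLpNorm (fun x => combinedLocalTime θ t (a n) n (fun k => S k ω) x -
        cellAverage (mesh J) (combinedLocalTime θ t (a n) n fun k => S k ω) x) p μ) +
      (eLpNorm (fun x => combinedLocalTime θ t (a n) n (fun k => S k ω) x -
        cellAverage (mesh J') (combinedLocalTime θ t (a n) n fun k => S k ω) x) p μ + ε) := by
    intro ω
    refine (min_le_right _ _).trans ?_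
    rw [stepMap, stepMap, enorm_cellStep_sub_cellStep]
    have mV := measurable_combinedLocalTime θ t (a n) n fun k => S k ω
    have mA := measurable_cellAverage (mesh J) (combinedLocalTime θ t (a n) n fun k => S k ω)
    have mA' := measurable_cellAverage (mesh J') (combinedLocalTime θ t (a n) n fun k => S k ω)
    have mc := measurable_comp_floor (fun j => combinedOccupation θ t (cellKernel (mesh J) j)
      (rescaledPath (a n) n fun k => S k ω)) (mesh J)
    have mc' := measurable_comp_floor (fun j => combinedOccupation θ t (cellKernel (mesh J') j)
      (rescaledPath (a n) n fun k => S k ω)) (mesh J')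
    refine (eLpNorm_sub_le_add hp1.out mc mV mc').trans (add_le_add ?_ ?_)
    · refine (eLpNorm_sub_le_add hp1.out mc mA mV).trans (add_le_add ?_ ?_)
      · rw [eLpNorm_fun_sub_comm]
        exact h3 _
      · rw [eLpNorm_fun_sub_comm]
    · exact (eLpNorm_sub_le_add hp1.out mV mA' mc').trans (add_le_add le_rfl (h4 _))
  have m1 := measurable_eLpNorm_combinedLocalTime_sub (p := p) (θ := θ) (t := t) hS (a n) n J μ
  have m2 := measurable_eLpNorm_combinedLocalTime_sub (p := p) (θ := θ) (t := t) hS (a n) n J' μ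
  refine (lintegral_mono hpt).trans ?_
  rw [lintegral_add_left (m1.const_add ε), lintegral_add_left measurable_const,
    lintegral_add_left m2, lintegral_const, measure_univ, mul_one]
  calc _ ≤ ε + ε + (ε + ε) := by gcongr
    _ = 4 * ε := by ring

/-- With J fixed and J' → ∞, the averages at mesh J' converge almost everywhere to the local time by
Lebesgue differentiation. Fatou's lemma, used once in x and once in ω, carries the Cauchy bound over
to the limit. -/
theorem eventually_lintegral_sub_cellAverage_le (hS : ∀ k, Measurable (S k))
    (ha : Tendsto a atTop atTop) (hL : IsLocalTime P' Y L)
    (hY : TendstoInDistribution (fun (n : ℕ) (ω : Ω) => rescaledPath (a n) n fun k => S k ω)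
      atTop Y (fun _ => P) P') (M : ℕ)
    (h : ∀ ε : ℝ≥0∞, 0 < ε → ∀ᶠ J in atTop, ∀ᶠ n in atTop,
      ∫⁻ ω, eLpNorm (fun x => combinedLocalTime θ t (a n) n (fun k => S k ω) x -
        cellAverage (mesh J) (combinedLocalTime θ t (a n) n fun k => S k ω) x) p
        (volume.restrict (Ico (-(M : ℝ)) M)) ∂P ≤ ε) {ε : ℝ≥0∞} (hε : 0 < ε) :
    ∀ᶠ J in atTop, ∫⁻ ω, min 1 (eLpNorm (fun x => (∑ i, θ i * L (t i) x ω) -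
        cellAverage (mesh J) (fun y => ∑ i, θ i * L (t i) y ω) x) p
        (volume.restrict (Ico (-(M : ℝ)) M))) ∂P' ≤ ε := by
  set μ := volume.restrict (Ico (-(M : ℝ)) M) with hμ
  have hε4 : 0 < ε / 4 := ENNReal.div_pos hε.ne' (by simp)
  have hev := h _ hε4
  filter_upwards [hev] with J hJ
  have hle : ∀ᶠ J' in atTop,
      ∫⁻ ω, min 1 ‖stepMap p θ t M J' (Y ω) - stepMap p θ t M J (Y ω)‖ₑ ∂P' ≤ ε := by
    filter_upwards [hev] with J' hJ'
    refine (lintegral_stepMap_sub_stepMap_le hS ha hY hε4 hJ' hJ).trans (le_of_eq ?_)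
    exact ENNReal.mul_div_cancel (by simp) (by simp)
  have hpt : ∀ᵐ ω ∂P', min 1 (eLpNorm (fun x => (∑ i, θ i * L (t i) x ω) -
      cellAverage (mesh J) (fun y => ∑ i, θ i * L (t i) y ω) x) p μ) ≤
      liminf (fun J' => min 1 ‖stepMap p θ t M J' (Y ω) - stepMap p θ t M J (Y ω)‖ₑ) atTop := by
    filter_upwards [hL.ae_integrable_combination θ t, hL.ae_cellAverage_eq θ t] with ω hω hω'
    have h1 : eLpNorm (fun x => (∑ i, θ i * L (t i) x ω) -
        cellAverage (mesh J) (fun y => ∑ i, θ i * L (t i) y ω) x) p μ ≤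
        liminf (fun J' => ‖stepMap p θ t M J' (Y ω) - stepMap p θ t M J (Y ω)‖ₑ) atTop := by
      have h2 := Lp.eLpNorm_lim_le_liminf_eLpNorm (p := p) (μ := μ)
        (f := fun J' x => cellAverage (mesh J') (fun y => ∑ i, θ i * L (t i) y ω) x -
          cellAverage (mesh J) (fun y => ∑ i, θ i * L (t i) y ω) x)
        (fun J' => ((measurable_cellAverage _ _).sub
          (measurable_cellAverage _ _)).aestronglyMeasurable)
        (fun x => (∑ i, θ i * L (t i) x ω) -
          cellAverage (mesh J) (fun y => ∑ i, θ i * L (t i) y ω) x)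
        (by
          filter_upwards [ae_restrict_of_ae (ae_tendsto_cellAverage hω)] with x hx
          exact hx.sub_const _)
      refine h2.trans (le_of_eq ?_)
      congr 1
      ext J'
      rw [stepMap, stepMap, enorm_cellStep_sub_cellStep]
      simp only [hω', hμ]
    refine (min_le_min_left 1 h1).trans (le_of_eq ?_)
    exact Monotone.map_liminf_of_continuousAt (f := fun u : ℝ≥0∞ => min 1 u)
      (fun _ _ h => min_le_min_left 1 h) _ (continuous_const.min continuous_id).continuousAt
  refine (lintegral_mono_ae hpt).trans ((lintegral_liminf_le' fun J' => ?_).trans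
    (liminf_le_of_frequently_le' hle.frequently))
  have hm : Measurable fun x => ENNReal.ofReal
      (min 1 ‖stepMap p θ t M J' x - stepMap p θ t M J x‖) :=
    (continuous_const.min ((continuous_stepMap θ t p M J').sub
      (continuous_stepMap θ t p M J)).norm).measurable.ennreal_ofReal
  simp only [ofReal_min_one_norm] at hm
  exact hm.comp_aemeasurable hY.aemeasurable_limit

end Limit

/-! ### Convergence in law in `L^p` -/

theorem proposition2p1
    {Ω Ω' : Type*} [MeasurableSpace Ω] [MeasurableSpace Ω']
    (P : Measure Ω) [IsProbabilityMeasure P] (P' : Measure Ω') [IsProbabilityMeasure P']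
    -- the `ℤ`-valued random sequence
    (S : ℕ → Ω → ℤ) (hS : ∀ k, Measurable (S k))
    -- convergence of the rescaled walk in `D([0,∞))` to a process `Y` with local time `L`
    (a : ℕ → ℝ) (ha : Tendsto a atTop atTop)
    (ha' : Tendsto (fun n : ℕ => (n : ℝ)⁻¹ * a n) atTop (𝓝 0))
    (Y : Ω' → SkorokhodSpace) (L : ℝ≥0 → ℝ → Ω' → ℝ) (hL : IsLocalTime P' Y L)
    (hY : TendstoInDistribution (fun (n : ℕ) (ω : Ω) => rescaledPath (a n) n fun k => S k ω)
      atTop Y (fun _ => P) P')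
    -- `L^p` modulus of continuity of the rescaled discrete local time
    (p : ℝ≥0∞) [Fact (1 ≤ p)] (hp : p ≠ ∞)
    (hRW2 : ∀ t : ℝ≥0, 0 < t → ∀ M : ℝ, 0 < M →
      Tendsto (fun δ : ℝ => limsup (fun n : ℕ => ∫⁻ x in Icc (-M) M, ∫⁻ ω,
          ‖rescaledLocalTime (a n) n (fun k => S k ω) t x
            - rescaledLocalTime (a n) n (fun k => S k ω) t (gridFloor δ x)‖ₑ ^ p.toReal ∂P) atTop)
        (𝓝[>] 0) (𝓝 0))
    (m : ℕ) (hm : 1 ≤ m) (θ : Fin m → ℝ) (t : Fin m → ℝ≥0) (ht0 : ∀ i, 0 < t i)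
    (ht : StrictMono t) :
    ∃ (X : ℕ → Ω → Lp ℝ p (volume : Measure ℝ)) (Z : Ω' → Lp ℝ p (volume : Measure ℝ)),
      (∀ n ω, X n ω =ᵐ[volume]
        fun x => ∑ i, θ i * rescaledLocalTime (a n) n (fun k => S k ω) (t i) x) ∧
      (∀ᵐ ω ∂P', Z ω =ᵐ[volume] fun x => ∑ i, θ i * L (t i) x ω) ∧
      TendstoInDistribution X atTop Z (fun _ => P) P' := by
  have hp1 : 1 ≤ p := Fact.out
  have hmod := fun (M : ℕ) (ε : ℝ≥0∞) (hε : 0 < ε) =>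
    eventually_lintegral_eLpNorm_sub_cellAverage_le θ t hS hp1 hp ht0 hRW2 M hε
  have hlim := fun (M : ℕ) (ε : ℝ≥0∞) (hε : 0 < ε) =>
    eventually_lintegral_sub_cellAverage_le (θ := θ) (t := t) hS ha hL hY M (hmod M) hε
  have hmem := ae_memLp_combination hp hL hlim
  set X : ℕ → Ω → Lp ℝ p (volume : Measure ℝ) := fun n ω =>
    (memLp_combinedLocalTime θ t (a n) n (fun k => S k ω) p).toLp _ with hX
  -- Membership in L^p is only almost sure; the default value 0 makes `Z` defined and measurable
  -- everywhere.
  set Z : Ω' → Lp ℝ p (volume : Measure ℝ) := fun ω =>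
    toLpOrZero p fun x => ∑ i, θ i * L (t i) x ω with hZ
  have hXeq : ∀ n ω, X n ω =ᵐ[volume] combinedLocalTime θ t (a n) n fun k => S k ω :=
    fun n ω => MemLp.coeFn_toLp _
  have hZeq : ∀ᵐ ω ∂P', Z ω =ᵐ[volume] fun x => ∑ i, θ i * L (t i) x ω :=
    hmem.mono fun ω hω => coeFn_toLpOrZero hω
  refine ⟨X, Z, hXeq, hZeq, tendstoInDistribution_of_forall_approx hY (fun n => ?_) ?_ ?_⟩
  · exact (measurable_comp_combinedLocalTime θ t hS (a n) n p fun f => f.2.toLp f.1).aemeasurable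
  · exact (measurable_toLpOrZero hp (hL.measurable_combination θ t)).aemeasurable
  intro ε hε
  have hε3 : 0 < ε / 3 := ENNReal.div_pos hε.ne' (by simp)
  set T : ℝ≥0 := Finset.univ.sup t with hT
  have htT : ∀ i, t i ≤ T := fun i => Finset.le_sup (Finset.mem_univ i)
  obtain ⟨M, hM⟩ := exists_lintegral_one_sub_containment_lt hY.aemeasurable_limit T hε3
  have hcont : Continuous fun x => 1 - SkorokhodSpace.containment M T x :=
    continuous_const.sub (SkorokhodSpace.continuous_containment M T)
  have hMn := (tendsto_lintegral_ofReal_comp hY hcont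
    (fun x => sub_nonneg.2 (SkorokhodSpace.containment_le_one _ _ _))
    (fun x => sub_le_self _ (SkorokhodSpace.containment_nonneg _ _ _))).eventually
    (gt_mem_nhds hM)
  -- One mesh must serve both the discrete and the limiting side. The half-width M + 2 comes from
  -- `rescaledLocalTime_eq_zero`.
  obtain ⟨J, hJ, hJ'⟩ := ((hmod (M + 2) _ hε3).and (hlim (M + 2) _ hε3)).exists
  have hmeas : Measurable fun x => ENNReal.ofReal (1 - SkorokhodSpace.containment M T x) :=
    hcont.measurable.ennreal_ofReal
  refine ⟨stepMap p θ t (M + 2) J, continuous_stepMap θ t p _ _,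
    (continuous_stepMap θ t p _ _).measurable, ?_, ?_⟩
  · filter_upwards [hMn, hJ, eventually_eLpNorm_cellAverage_sub_le θ t ha p (M + 2) J hε3,
      ha.eventually_ge_atTop 1, eventually_ne_atTop 0] with n h1 h2 h3 h4 h5
    -- Three errors of size ε/3: escape from the window, the modulus term of (RW2), and the
    -- deterministic comparison with the occupation integrals.
    have hpt : ∀ ω, min 1 ‖X n ω - stepMap p θ t (M + 2) J (rescaledPath (a n) n fun k => S k ω)‖ₑ ≤
        ENNReal.ofReal (1 - SkorokhodSpace.containment M T (rescaledPath (a n) n fun k => S k ω)) +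
        (eLpNorm (fun x => combinedLocalTime θ t (a n) n (fun k => S k ω) x -
          cellAverage (mesh J) (combinedLocalTime θ t (a n) n fun k => S k ω) x) p
          (volume.restrict (Ico (-((M + 2 : ℕ) : ℝ)) (M + 2 : ℕ))) + ε / 3) := by
      intro ω
      refine (min_one_enorm_sub_cellStep_le J _ (hXeq n ω)
        (κ := SkorokhodSpace.containment M T (rescaledPath (a n) n fun k => S k ω))
        fun hκ => ae_of_all _ fun x hx => ?_).trans ?_
      · refine Finset.sum_eq_zero fun i _ => ?_
        rw [rescaledLocalTime_eq_zero h4 h5 (M := M) (fun r hr =>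
          SkorokhodSpace.abs_lt_of_containment_ne_zero hκ (hr.trans (htT i))) (by
            push_cast at hx; exact hx), mul_zero]
      · refine add_le_add le_rfl ((min_le_right _ _).trans ?_)
        exact (eLpNorm_sub_le_add hp1 (measurable_combinedLocalTime θ t _ _ _)
          (measurable_cellAverage (mesh J) _) (measurable_comp_floor (fun j =>
            combinedOccupation θ t (cellKernel (mesh J) j) (rescaledPath (a n) n fun k => S k ω))
            (mesh J))).trans (add_le_add le_rfl (h3 _))
    have hmn : AEMeasurable (fun ω => ENNReal.ofReal (1 - SkorokhodSpace.containment M T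
        (rescaledPath (a n) n fun k => S k ω))) P :=
      hmeas.comp_aemeasurable (hY.forall_aemeasurable n)
    refine (lintegral_mono hpt).trans ?_
    rw [lintegral_add_left' hmn,
      lintegral_add_right _ measurable_const, lintegral_const, measure_univ, mul_one, ← add_assoc]
    exact (add_le_add (add_le_add h1.le h2) le_rfl).trans (ENNReal.add_thirds ε).le
  -- Only two errors occur for the limit, since its cell averages equal the occupation integrals
  -- exactly.
  · have hpt : ∀ᵐ ω ∂P', min 1 ‖Z ω - stepMap p θ t (M + 2) J (Y ω)‖ₑ ≤
        ENNReal.ofReal (1 - SkorokhodSpace.containment M T (Y ω)) +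
        min 1 (eLpNorm (fun x => (∑ i, θ i * L (t i) x ω) -
          cellAverage (mesh J) (fun y => ∑ i, θ i * L (t i) y ω) x) p
          (volume.restrict (Ico (-((M + 2 : ℕ) : ℝ)) (M + 2 : ℕ)))) := by
      filter_upwards [hZeq, hL.ae_combination_eq_zero θ t, hL.ae_cellAverage_eq θ t]
        with ω h1 h2 h3
      simp only [h3]
      exact min_one_enorm_sub_cellStep_le J _ h1 fun hκ => h2 M fun i r hr =>
        SkorokhodSpace.abs_lt_of_containment_ne_zero hκ (hr.trans (htT i))
    have hml : AEMeasurable (fun ω =>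
        ENNReal.ofReal (1 - SkorokhodSpace.containment M T (Y ω))) P' :=
      hmeas.comp_aemeasurable hY.aemeasurable_limit
    refine (lintegral_mono_ae hpt).trans ?_
    rw [lintegral_add_left' hml]
    exact (add_le_add hM.le hJ').trans (le_self_add.trans (ENNReal.add_thirds ε).le)
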